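/- Let $(M,g)$ be a compact two-dimensional smooth ($C^\infty$, Hausdorff) Riemannian manifold without boundary, with Ricci tensor $\mathrm{Ric}$ and scalar curvature $s$ (the $g$-trace of $\mathrm{Ric}$). Let $V$ be a smooth vector field and $\lambda$ a smooth real function on $M$ such that $(M,g,V,\lambda)$ is an almost Ricci soliton, i.e. $$\mathrm{Ric} = \tfrac12 L_V g + \lambda g ,$$ where $L_V g$ is the Lie derivative of $g$ along $V$. Suppose that $s \le 0$ everywhere on $M$. Then: (i) if $s < 0$ everywhere on $M$, the soliton is trivial, i.e. $V \equiv 0$; (ii) if $V$ vanishes nowhere, $(M,g)$ is locally isometric to the Euclidean plane: every point of $M$ has an open neighbourhood which is isometric to an open subset of $\mathbb{R}^2$. -/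

import Mathlib

open scoped Manifold ContDiff

noncomputable section

namespace AlmostRicciSoliton

/-- Smooth Riemannian metrics on an `n`-dimensional manifold `M` (without boundary). -/
abbrev Metric (n : ℕ) (M : Type*) [TopologicalSpace M]
    [ChartedSpace (EuclideanSpace ℝ (Fin n)) M] [IsManifold (𝓡 n) ∞ M] :=
  Bundle.ContMDiffRiemannianMetric (𝓡 n) ∞ (EuclideanSpace ℝ (Fin n))
    (fun x : M => TangentSpace (𝓡 n) x)

/-- The partial derivative `∂ₖ f` at `y`, for a real function `f` on `ℝⁿ`. -/
def partialDeriv {n : ℕ} (k : Fin n) (f : EuclideanSpace ℝ (Fin n) → ℝ)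
    (y : EuclideanSpace ℝ (Fin n)) : ℝ :=
  fderiv ℝ f y (EuclideanSpace.single k 1)

section Coordinates

/-! ### Tensors in the local coordinates given by a chart `e`

All functions are functions of the coordinates `y`, meaningful on `e.target`. -/

variable {n : ℕ} {M : Type*} [TopologicalSpace M]
  [ChartedSpace (EuclideanSpace ℝ (Fin n)) M] [IsManifold (𝓡 n) ∞ M]

/-- The `i`-th coordinate vector field of the chart `e`, at the point with coordinates `y`. -/
def coordVector (e : OpenPartialHomeomorph M (EuclideanSpace ℝ (Fin n))) (i : Fin n)
    (y : EuclideanSpace ℝ (Fin n)) : TangentSpace (𝓡 n) (e.symm y) :=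
  mfderiv (𝓡 n) (𝓡 n) e.symm y (EuclideanSpace.single i (1 : ℝ))

/-- The `i`-th component, in the chart `e`, of a tangent vector `v` at `p`. -/
def component (e : OpenPartialHomeomorph M (EuclideanSpace ℝ (Fin n))) (p : M)
    (v : TangentSpace (𝓡 n) p) (i : Fin n) : ℝ :=
  EuclideanSpace.proj (𝕜 := ℝ) i (mfderiv (𝓡 n) (𝓡 n) e p v)

/-- The matrix `(gᵢⱼ)` of the metric. -/
def gram (g : Metric n M) (e : OpenPartialHomeomorph M (EuclideanSpace ℝ (Fin n)))
    (y : EuclideanSpace ℝ (Fin n)) : Matrix (Fin n) (Fin n) ℝ :=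
  Matrix.of fun i j => g.inner (e.symm y) (coordVector e i y) (coordVector e j y)

/-- The Christoffel symbol `Γᵏᵢⱼ = ½ gᵏˡ (∂ᵢ gⱼₗ + ∂ⱼ gᵢₗ - ∂ₗ gᵢⱼ)` of the Levi-Civita connection. -/
def christoffel (g : Metric n M) (e : OpenPartialHomeomorph M (EuclideanSpace ℝ (Fin n)))
    (k i j : Fin n) (y : EuclideanSpace ℝ (Fin n)) : ℝ :=
  (1 / 2) * ∑ l, (gram g e y)⁻¹ k l *
    (partialDeriv i (fun z => gram g e z j l) y + partialDeriv j (fun z => gram g e z i l) y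
      - partialDeriv l (fun z => gram g e z i j) y)

/-- The components of the Ricci tensor,
`Rᵢⱼ = ∂ₖ Γᵏᵢⱼ - ∂ⱼ Γᵏᵢₖ + Γᵏₖₗ Γˡᵢⱼ - Γᵏⱼₗ Γˡᵢₖ`. -/
def ricciCoord (g : Metric n M) (e : OpenPartialHomeomorph M (EuclideanSpace ℝ (Fin n)))
    (i j : Fin n) (y : EuclideanSpace ℝ (Fin n)) : ℝ :=
  ∑ k, (partialDeriv k (christoffel g e k i j) y - partialDeriv j (christoffel g e k i k) y
    + ∑ l, (christoffel g e k k l y * christoffel g e l i j y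
      - christoffel g e k j l y * christoffel g e l i k y))

/-- The scalar curvature `gⁱʲ Rᵢⱼ`. -/
def scalarCoord (g : Metric n M) (e : OpenPartialHomeomorph M (EuclideanSpace ℝ (Fin n)))
    (y : EuclideanSpace ℝ (Fin n)) : ℝ :=
  ∑ i, ∑ j, (gram g e y)⁻¹ i j * ricciCoord g e i j y

/-- The component `Vⁱ` of a vector field, as a function of the coordinates. -/
def fieldCoord (V : (x : M) → TangentSpace (𝓡 n) x)
    (e : OpenPartialHomeomorph M (EuclideanSpace ℝ (Fin n))) (i : Fin n)
    (y : EuclideanSpace ℝ (Fin n)) : ℝ :=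
  component e (e.symm y) (V (e.symm y)) i

/-- The components of the Lie derivative of the metric,
`(L_V g)ᵢⱼ = Vᵏ ∂ₖ gᵢⱼ + gₖⱼ ∂ᵢ Vᵏ + gᵢₖ ∂ⱼ Vᵏ`. -/
def lieMetricCoord (g : Metric n M) (V : (x : M) → TangentSpace (𝓡 n) x)
    (e : OpenPartialHomeomorph M (EuclideanSpace ℝ (Fin n))) (i j : Fin n)
    (y : EuclideanSpace ℝ (Fin n)) : ℝ :=
  ∑ k, (fieldCoord V e k y * partialDeriv k (fun z => gram g e z i j) y
    + gram g e y k j * partialDeriv i (fieldCoord V e k) y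
    + gram g e y i k * partialDeriv j (fieldCoord V e k) y)

end Coordinates

section Global

/-! ### The tensors on the manifold

Their values at `p` do not depend on the chart; they are computed in the preferred chart at `p`. -/

variable {n : ℕ} {M : Type*} [TopologicalSpace M]
  [ChartedSpace (EuclideanSpace ℝ (Fin n)) M] [IsManifold (𝓡 n) ∞ M]

/-- The Ricci tensor `Ric(u, v)` at `p`. -/
def ricci (g : Metric n M) (p : M) (u v : TangentSpace (𝓡 n) p) : ℝ :=
  let e := chartAt (EuclideanSpace ℝ (Fin n)) p
  ∑ i, ∑ j, ricciCoord g e i j (e p) * component e p u i * component e p v j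

/-- The Lie derivative `(L_V g)(u, v)` at `p`. -/
def lieMetric (g : Metric n M) (V : (x : M) → TangentSpace (𝓡 n) x) (p : M)
    (u v : TangentSpace (𝓡 n) p) : ℝ :=
  let e := chartAt (EuclideanSpace ℝ (Fin n)) p
  ∑ i, ∑ j, lieMetricCoord g V e i j (e p) * component e p u i * component e p v j

/-- The scalar curvature at `p`. -/
def scalarCurvature (g : Metric n M) (p : M) : ℝ :=
  let e := chartAt (EuclideanSpace ℝ (Fin n)) p
  scalarCoord g e (e p)

/-- `(M, g, V, lam)` is an almost Ricci soliton: `V` is a smooth vector field, `lam` is a smooth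
function and `Ric = ½ L_V g + lam g`. -/
structure IsAlmostRicciSoliton (g : Metric n M) (V : (x : M) → TangentSpace (𝓡 n) x)
    (lam : M → ℝ) : Prop where
  smooth_field : ContMDiff (𝓡 n) (𝓡 n).tangent ∞ (fun x => (⟨x, V x⟩ : TangentBundle (𝓡 n) M))
  smooth_fun : ContMDiff (𝓡 n) 𝓘(ℝ, ℝ) ∞ lam
  eqn : ∀ (p : M) (u v : TangentSpace (𝓡 n) p),
    ricci g p u v = (1 / 2) * lieMetric g V p u v + lam p * g.inner p u v

/-- An almost Ricci soliton is trivial if its vector field vanishes identically. -/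
def IsTrivial (V : (x : M) → TangentSpace (𝓡 n) x) : Prop :=
  ∀ x, V x = 0

/-- `(M, g)` is locally isometric to `ℝⁿ`: around every point there is a smooth diffeomorphism
from an open set of `M` onto an open set of `ℝⁿ` which preserves the metric. -/
def LocallyIsometricToEuclidean (g : Metric n M) : Prop :=
  ∀ p : M, ∃ Φ : OpenPartialHomeomorph M (EuclideanSpace ℝ (Fin n)),
    p ∈ Φ.source ∧ ContMDiffOn (𝓡 n) (𝓡 n) ∞ Φ Φ.source ∧
    ContMDiffOn (𝓡 n) (𝓡 n) ∞ Φ.symm Φ.target ∧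
    ∀ x ∈ Φ.source, ∀ u v : TangentSpace (𝓡 n) x,
      @inner ℝ (EuclideanSpace ℝ (Fin n)) _
        (mfderiv (𝓡 n) (𝓡 n) Φ x u) (mfderiv (𝓡 n) (𝓡 n) Φ x v) = g.inner x u v

end Global

end AlmostRicciSoliton

end

/-!
On a surface `Ric = (s / 2) g`, so the soliton equation `Ric = ½ L_V g + lam g` says exactly that
`V` is a conformal field: `L_V g = (s - 2 lam) g`. Let `W` be `V` rotated by a right angle. Where
`V ≠ 0`, the Bochner formula for a conformal field on a surface reads
`V (V log |V|²) + W (W log |V|²) = - s |V|²` (`IsLeviCivitaNear.bochner`). It comes from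
the decomposition `∇V = a + τ √det g J` of the covariant derivative of a conformal field, with `J`
the rotation (`IsLeviCivitaNear.covDeriv_eq`), and from the Ricci identity
(`IsLeviCivitaNear.dilation_twist`).

If `s < 0`, then at a maximum of `|V|²` with `V ≠ 0` the left side is nonpositive and the right side
positive, so `V` vanishes identically (`IsAlmostRicciSoliton.isTrivial`).

If `V` has no zeros, the `1`-forms `g(V, ·) / |V|²` and `g(W, ·) / |V|²` are closed
(`coframe_closed`). Their primitives are coordinates in which the metric `g / |V|²` is Euclidean and
`V`, `± W` are the coordinate fields (`IsAlmostRicciSoliton.exists_isFlatChart`). Hence `log |V|²` is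
subharmonic in these coordinates when `s ≤ 0`. By compactness and the strong maximum principle
(`eq_of_isMax_of_viscosity_subharmonic`), `|V|²` is constant on each connected component, so that
`g` is itself Euclidean up to a constant factor.

The curvature is evaluated only at the centre of a preferred chart, where it is defined. For
this reason subharmonicity is used in the viscosity sense: a function is tested at one point at a
time, in the preferred chart of that point. Only the conformal equation has to be carried from
chart to chart (`lieOf_change`).
-/

namespace AlmostRicciSoliton

open Filter Topology

/-! ### Partial derivatives -/

section PartialDeriv

variable {n : ℕ} {f h : EuclideanSpace ℝ (Fin n) → ℝ} {y : EuclideanSpace ℝ (Fin n)}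

lemma partialDeriv_add (k : Fin n) (hf : DifferentiableAt ℝ f y) (hh : DifferentiableAt ℝ h y) :
    partialDeriv k (fun z => f z + h z) y = partialDeriv k f y + partialDeriv k h y := by
  simp [partialDeriv, fderiv_fun_add hf hh]

lemma partialDeriv_sub (k : Fin n) (hf : DifferentiableAt ℝ f y) (hh : DifferentiableAt ℝ h y) :
    partialDeriv k (fun z => f z - h z) y = partialDeriv k f y - partialDeriv k h y := by
  simp [partialDeriv, fderiv_fun_sub hf hh]

lemma partialDeriv_mul (k : Fin n) (hf : DifferentiableAt ℝ f y) (hh : DifferentiableAt ℝ h y) :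
    partialDeriv k (fun z => f z * h z) y = f y * partialDeriv k h y + h y * partialDeriv k f y := by
  simp [partialDeriv, fderiv_fun_mul hf hh]

lemma partialDeriv_neg (k : Fin n) :
    partialDeriv k (fun z => - f z) y = - partialDeriv k f y := by
  simp [partialDeriv, fderiv_fun_neg]

lemma partialDeriv_const_mul (k : Fin n) (c : ℝ) (hf : DifferentiableAt ℝ f y) :
    partialDeriv k (fun z => c * f z) y = c * partialDeriv k f y := by
  simp [partialDeriv, fderiv_const_mul hf]

lemma partialDeriv_inv (k : Fin n) (hf : DifferentiableAt ℝ f y) (h0 : f y ≠ 0) :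
    partialDeriv k (fun z => (f z)⁻¹) y = - partialDeriv k f y / f y ^ 2 := by
  have := (hasDerivAt_inv h0).comp_hasFDerivAt y hf.hasFDerivAt
  have h2 : fderiv ℝ (fun z => (f z)⁻¹) y = _ := this.fderiv
  simp [partialDeriv, h2]
  ring

lemma partialDeriv_log (k : Fin n) (hf : DifferentiableAt ℝ f y) (h0 : f y ≠ 0) :
    partialDeriv k (fun z => Real.log (f z)) y = partialDeriv k f y / f y := by
  simp [partialDeriv, fderiv.log hf h0]
  ring

lemma partialDeriv_sqrt (k : Fin n) (hf : DifferentiableAt ℝ f y) (h0 : f y ≠ 0) :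
    partialDeriv k (fun z => √(f z)) y = partialDeriv k f y / (2 * √(f y)) := by
  simp [partialDeriv, fderiv_sqrt hf h0]
  ring

lemma partialDeriv_eventuallyEq (k : Fin n) (hfh : f =ᶠ[𝓝 y] h) :
    partialDeriv k f =ᶠ[𝓝 y] partialDeriv k h := by
  filter_upwards [hfh.fderiv (𝕜 := ℝ)] with z hz
  simp [partialDeriv, hz]

lemma partialDeriv_congr (k : Fin n) (hfh : ∀ᶠ z in 𝓝 y, f z = h z) :
    partialDeriv k f y = partialDeriv k h y :=
  (partialDeriv_eventuallyEq k hfh).eq_of_nhds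

lemma contDiffAt_partialDeriv (k : Fin n) (hf : ContDiffAt ℝ ∞ f y) :
    ContDiffAt ℝ ∞ (partialDeriv k f) y :=
  ContDiffAt.clm_apply (hf.fderiv_right (m := ∞) (by simp)) contDiffAt_const

lemma partialDeriv_comm (i j : Fin n) (hf : ContDiffAt ℝ ∞ f y) :
    partialDeriv i (partialDeriv j f) y = partialDeriv j (partialDeriv i f) y := by
  have hd : DifferentiableAt ℝ (fderiv ℝ f) y :=
    (hf.fderiv_right (m := ∞) (by simp)).differentiableAt (by simp)
  have key : ∀ a b : Fin n, partialDeriv a (partialDeriv b f) y =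
      fderiv ℝ (fderiv ℝ f) y (EuclideanSpace.single a 1) (EuclideanSpace.single b 1) := by
    intro a b
    unfold partialDeriv
    rw [fderiv_clm_apply hd (differentiableAt_const _)]
    simp
  rw [key, key]
  exact (hf.isSymmSndFDerivAt (by simp; exact ENat.LEInfty.out)).eq _ _

lemma fderiv_eq_sum_partialDeriv (v : EuclideanSpace ℝ (Fin n)) :
    fderiv ℝ f y v = ∑ i, v i * partialDeriv i f y := by
  conv_lhs => rw [← (EuclideanSpace.basisFun (Fin n) ℝ).sum_repr v]
  simp [partialDeriv]

end PartialDeriv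

/-! ### The curvature of a metric in the plane -/

section Curvature

/-- The curvature operator `R(∂₀, ∂₁) ∂ᵢ = (curvature Γ l i) ∂ₗ` of the connection with
Christoffel symbols `Γ k i j = Γᵏᵢⱼ` on a domain of the plane. -/
noncomputable def curvature (Γ : Fin 2 → Fin 2 → Fin 2 → EuclideanSpace ℝ (Fin 2) → ℝ) (l i : Fin 2)
    (y : EuclideanSpace ℝ (Fin 2)) : ℝ :=
  partialDeriv 0 (Γ l 1 i) y - partialDeriv 1 (Γ l 0 i) y
    + ∑ m, (Γ l 0 m y * Γ m 1 i y - Γ l 1 m y * Γ m 0 i y)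

/-- `Γ` are the Christoffel symbols of a torsion-free connection compatible with the metric with
coefficients `G`, near `y`; everything is smooth at `y`. -/
structure IsLeviCivitaNear (G : Fin 2 → Fin 2 → EuclideanSpace ℝ (Fin 2) → ℝ)
    (Γ : Fin 2 → Fin 2 → Fin 2 → EuclideanSpace ℝ (Fin 2) → ℝ)
    (y : EuclideanSpace ℝ (Fin 2)) : Prop where
  smooth : ∀ i j, ContDiffAt ℝ ∞ (G i j) y
  smooth_symbol : ∀ k i j, ContDiffAt ℝ ∞ (Γ k i j) y
  symm : ∀ i j, G i j = G j i
  symm_symbol : ∀ k i j, Γ k i j = Γ k j i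
  pos : ∀ᶠ z in 𝓝 y, 0 < G 0 0 z ∧ 0 < G 1 1 z ∧ 0 < G 0 0 z * G 1 1 z - G 0 1 z * G 0 1 z
  compat : ∀ k i j, ∀ᶠ z in 𝓝 y, partialDeriv k (G i j) z =
    ∑ l, (G l j z * Γ l k i z + G i l z * Γ l k j z)

variable {G : Fin 2 → Fin 2 → EuclideanSpace ℝ (Fin 2) → ℝ}
  {Γ : Fin 2 → Fin 2 → Fin 2 → EuclideanSpace ℝ (Fin 2) → ℝ} {y : EuclideanSpace ℝ (Fin 2)}

/-- The curvature operator of a metric connection is skew-adjoint. -/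
lemma IsLeviCivitaNear.curvature_skew (h : IsLeviCivitaNear G Γ y) (i j : Fin 2) :
    ∑ l, (G l j y * curvature Γ l i y + G i l y * curvature Γ l j y) = 0 := by
  have hG : ∀ i j, DifferentiableAt ℝ (G i j) y := fun i j => (h.smooth i j).differentiableAt (by simp)
  have hΓ : ∀ k i j, DifferentiableAt ℝ (Γ k i j) y :=
    fun k i j => (h.smooth_symbol k i j).differentiableAt (by simp)
  have h01 : ∀ k m, partialDeriv m (partialDeriv k (G i j)) y =
      ∑ l, (G l j y * partialDeriv m (Γ l k i) y + Γ l k i y * partialDeriv m (G l j) y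
        + (G i l y * partialDeriv m (Γ l k j) y + Γ l k j y * partialDeriv m (G i l) y)) := by
    intro k m
    rw [partialDeriv_congr m (h.compat k i j)]
    simp only [Fin.sum_univ_two]
    rw [partialDeriv_add _ (by fun_prop) (by fun_prop), partialDeriv_add _ (by fun_prop) (by fun_prop),
      partialDeriv_add _ (by fun_prop) (by fun_prop), partialDeriv_mul _ (by fun_prop) (by fun_prop),
      partialDeriv_mul _ (by fun_prop) (by fun_prop), partialDeriv_mul _ (by fun_prop) (by fun_prop),
      partialDeriv_mul _ (by fun_prop) (by fun_prop)]
  have hcomm := partialDeriv_comm 0 1 (h.smooth i j)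
  rw [h01, h01] at hcomm
  have hc : ∀ k i j, partialDeriv k (G i j) y = ∑ l, (G l j y * Γ l k i y + G i l y * Γ l k j y) :=
    fun k i j => (h.compat k i j).self_of_nhds
  simp only [hc, Fin.sum_univ_two, curvature] at hcomm ⊢
  linear_combination hcomm

/-- The Ricci tensor of a torsion-free connection in coordinates. -/
noncomputable def ricciOf (Γ : Fin 2 → Fin 2 → Fin 2 → EuclideanSpace ℝ (Fin 2) → ℝ) (i j : Fin 2)
    (y : EuclideanSpace ℝ (Fin 2)) : ℝ :=
  ∑ k, (partialDeriv k (Γ k i j) y - partialDeriv j (Γ k i k) y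
    + ∑ l, (Γ k k l y * Γ l i j y - Γ k j l y * Γ l i k y))

lemma ricciOf_eq_curvature (hsymm : ∀ k i j, Γ k i j = Γ k j i) :
    ricciOf Γ 0 0 y = - curvature Γ 1 0 y ∧ ricciOf Γ 0 1 y = curvature Γ 0 0 y ∧
    ricciOf Γ 1 0 y = - curvature Γ 1 1 y ∧ ricciOf Γ 1 1 y = curvature Γ 0 1 y := by
  simp only [ricciOf, curvature, Fin.sum_univ_two, hsymm _ 1 0]
  refine ⟨?_, ?_, ?_, ?_⟩ <;> ring

/-- On a surface the Ricci tensor is half the scalar curvature times the metric. -/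
lemma IsLeviCivitaNear.ricciOf_eq (h : IsLeviCivitaNear G Γ y) (i j : Fin 2) :
    ricciOf Γ i j y = (G 1 1 y * ricciOf Γ 0 0 y - G 0 1 y * ricciOf Γ 0 1 y
      - G 0 1 y * ricciOf Γ 1 0 y + G 0 0 y * ricciOf Γ 1 1 y)
      / (G 0 0 y * G 1 1 y - G 0 1 y * G 0 1 y) / 2 * G i j y := by
  obtain ⟨p0, p1, pd⟩ := h.pos.self_of_nhds
  have s00 := h.curvature_skew 0 0
  have s01 := h.curvature_skew 0 1
  have s11 := h.curvature_skew 1 1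
  obtain ⟨r00, r01, r10, r11⟩ := ricciOf_eq_curvature (y := y) h.symm_symbol
  have r00' : curvature Γ 1 0 y = - ricciOf Γ 0 0 y := by rw [r00]; ring
  have r10' : curvature Γ 1 1 y = - ricciOf Γ 1 0 y := by rw [r10]; ring
  have hsym := congrFun (h.symm 1 0) y
  simp only [Fin.sum_univ_two, r00', r10', ← r01, ← r11, hsym] at s00 s01 s11
  clear r00 r01 r10 r11 r00' r10'
  generalize hR00 : ricciOf Γ 0 0 y = R00 at *
  generalize hR01 : ricciOf Γ 0 1 y = R01 at *
  generalize hR10 : ricciOf Γ 1 0 y = R10 at *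
  generalize hR11 : ricciOf Γ 1 1 y = R11 at *
  generalize hb : G 0 1 y = b at *
  generalize ha : G 0 0 y = a at *
  generalize hc : G 1 1 y = c at *
  have e01 : R01 = b * R00 / a := by
    field_simp; linear_combination s00 / 2
  have e10 : R10 = b * R11 / c := by
    field_simp; linear_combination - s11 / 2
  have e11 : R11 = c * R00 / a := by
    have : (a * c - b * b) * (a * R11 - c * R00) = 0 := by
      subst e01 e10
      field_simp at s01
      linear_combination s01
    have := (mul_eq_zero.1 this).resolve_left pd.ne'
    field_simp; linear_combination this
  have hR : (c * R00 - b * R01 - b * R10 + a * R11) / (a * c - b * b) / 2 = R00 / a := by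
    subst e10; subst e11; subst e01
    rw [div_div, div_eq_div_iff (by positivity) p0.ne']
    field_simp
    ring
  rw [hR]
  subst e10; subst e11; subst e01
  fin_cases i <;> fin_cases j <;> simp [ha, hb, hc, hsym, hR00, hR01, hR10, hR11] <;>
    field_simp

end Curvature

/-! ### Conformal fields in coordinates -/

section Conformal

/-- The derivative `X f` of a function along the vector field with components `X i`. -/
noncomputable def dirDeriv (X : Fin 2 → EuclideanSpace ℝ (Fin 2) → ℝ)
    (f : EuclideanSpace ℝ (Fin 2) → ℝ) (y : EuclideanSpace ℝ (Fin 2)) : ℝ :=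
  ∑ i, X i y * partialDeriv i f y

/-- The determinant of the symmetric matrix with entries `G i j`. -/
noncomputable def gramDet (G : Fin 2 → Fin 2 → EuclideanSpace ℝ (Fin 2) → ℝ)
    (y : EuclideanSpace ℝ (Fin 2)) : ℝ :=
  G 0 0 y * G 1 1 y - G 0 1 y * G 0 1 y

/-- The squared length of the vector field `V` for the metric with coefficients `G`. -/
noncomputable def normSq (G : Fin 2 → Fin 2 → EuclideanSpace ℝ (Fin 2) → ℝ)
    (V : Fin 2 → EuclideanSpace ℝ (Fin 2) → ℝ) (y : EuclideanSpace ℝ (Fin 2)) : ℝ :=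
  G 0 0 y * (V 0 y * V 0 y) + 2 * (G 0 1 y * (V 0 y * V 1 y)) + G 1 1 y * (V 1 y * V 1 y)

/-- The vector field `V` rotated by a right angle, in the metric with coefficients `G`; the
orientation is the one of the coordinates. -/
noncomputable def rotated (G : Fin 2 → Fin 2 → EuclideanSpace ℝ (Fin 2) → ℝ)
    (V : Fin 2 → EuclideanSpace ℝ (Fin 2) → ℝ) :
    Fin 2 → EuclideanSpace ℝ (Fin 2) → ℝ :=
  ![fun y => -(G 0 1 y * V 0 y + G 1 1 y * V 1 y) * (√(gramDet G y))⁻¹,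
    fun y => (G 0 0 y * V 0 y + G 0 1 y * V 1 y) * (√(gramDet G y))⁻¹]

variable {G : Fin 2 → Fin 2 → EuclideanSpace ℝ (Fin 2) → ℝ}
  {Γ : Fin 2 → Fin 2 → Fin 2 → EuclideanSpace ℝ (Fin 2) → ℝ}
  {V : Fin 2 → EuclideanSpace ℝ (Fin 2) → ℝ}
  {y : EuclideanSpace ℝ (Fin 2)}

/-- The components of the Lie derivative along `V` of the metric with coefficients `G`. -/
noncomputable def lieOf (G : Fin 2 → Fin 2 → EuclideanSpace ℝ (Fin 2) → ℝ)
    (V : Fin 2 → EuclideanSpace ℝ (Fin 2) → ℝ) (i j : Fin 2)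
    (y : EuclideanSpace ℝ (Fin 2)) : ℝ :=
  ∑ k, (V k y * partialDeriv k (G i j) y + G k j y * partialDeriv i (V k) y
    + G i k y * partialDeriv j (V k) y)

/-- The components `(∇ᵢ V)ʲ` of the covariant derivative. -/
noncomputable def covDeriv (Γ : Fin 2 → Fin 2 → Fin 2 → EuclideanSpace ℝ (Fin 2) → ℝ)
    (V : Fin 2 → EuclideanSpace ℝ (Fin 2) → ℝ) (i j : Fin 2)
    (y : EuclideanSpace ℝ (Fin 2)) : ℝ :=
  partialDeriv i (V j) y + (Γ j i 0 y * V 0 y + Γ j i 1 y * V 1 y)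

lemma normSq_pos (h0 : 0 < G 0 0 y) (hd : 0 < gramDet G y) (hV : V 0 y ≠ 0 ∨ V 1 y ≠ 0) :
    0 < normSq G V y := by
  have h : G 0 0 y * normSq G V y =
      (G 0 0 y * V 0 y + G 0 1 y * V 1 y) ^ 2 + gramDet G y * V 1 y ^ 2 := by
    unfold normSq gramDet; ring
  have : 0 < G 0 0 y * normSq G V y := by
    rw [h]
    by_cases h1 : V 1 y = 0
    · have h2 : V 0 y ≠ 0 := by tauto
      simp only [h1]
      have : 0 < (G 0 0 y * V 0 y) ^ 2 := by positivity
      simpa using this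
    · positivity
  exact pos_of_mul_pos_right this h0.le

/-- The twist `τ` of a conformal field: `∇V` is half the divergence times the identity plus
`τ √det G` times the rotation. -/
noncomputable def twist (G : Fin 2 → Fin 2 → EuclideanSpace ℝ (Fin 2) → ℝ)
    (Γ : Fin 2 → Fin 2 → Fin 2 → EuclideanSpace ℝ (Fin 2) → ℝ)
    (V : Fin 2 → EuclideanSpace ℝ (Fin 2) → ℝ) (y : EuclideanSpace ℝ (Fin 2)) : ℝ :=
  covDeriv Γ V 0 1 y * (G 0 0 y)⁻¹

/-- The dilation `a` of a conformal field `V`, with `L_V g = 2 a g`. -/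
noncomputable def dilation (G : Fin 2 → Fin 2 → EuclideanSpace ℝ (Fin 2) → ℝ)
    (Γ : Fin 2 → Fin 2 → Fin 2 → EuclideanSpace ℝ (Fin 2) → ℝ)
    (V : Fin 2 → EuclideanSpace ℝ (Fin 2) → ℝ) (y : EuclideanSpace ℝ (Fin 2)) : ℝ :=
  covDeriv Γ V 0 0 y + twist G Γ V y * G 0 1 y

/-- The covariant derivative of a conformal field on a surface commutes with the rotation. -/
lemma IsLeviCivitaNear.covDeriv_eq (h : IsLeviCivitaNear G Γ y)
    {σ : EuclideanSpace ℝ (Fin 2) → ℝ}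
    (hconf : ∀ᶠ z in 𝓝 y, ∀ i j, lieOf G V i j z = σ z * G i j z) :
    ∀ᶠ z in 𝓝 y, covDeriv Γ V 0 0 z = dilation G Γ V z - twist G Γ V z * G 0 1 z ∧
      covDeriv Γ V 0 1 z = twist G Γ V z * G 0 0 z ∧
      covDeriv Γ V 1 0 z = - twist G Γ V z * G 1 1 z ∧
      covDeriv Γ V 1 1 z = dilation G Γ V z + twist G Γ V z * G 0 1 z := by
  have hcompat := h.compat
  simp only [← eventually_all] at hcompat
  filter_upwards [h.pos, hconf, hcompat] with z hz hcz hkz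
  obtain ⟨p0, p1, pd⟩ := hz
  have c00 := hcz 0 0
  have c01 := hcz 0 1
  have c11 := hcz 1 1
  simp only [lieOf, Fin.sum_univ_two, hkz, h.symm 1 0, h.symm_symbol _ 1 0] at c00 c01 c11
  have e00 : covDeriv Γ V 0 0 z = dilation G Γ V z - twist G Γ V z * G 0 1 z := by
    simp [dilation]
  have e01 : covDeriv Γ V 0 1 z = twist G Γ V z * G 0 0 z := by
    simp [twist, p0.ne']
  have d00 : 2 * (G 0 0 z * covDeriv Γ V 0 0 z + G 0 1 z * covDeriv Γ V 0 1 z) = σ z * G 0 0 z := by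
    simp only [covDeriv]; linear_combination c00
  have d01 : G 0 1 z * covDeriv Γ V 0 0 z + G 1 1 z * covDeriv Γ V 0 1 z +
      G 0 0 z * covDeriv Γ V 1 0 z + G 0 1 z * covDeriv Γ V 1 1 z = σ z * G 0 1 z := by
    simp only [covDeriv, h.symm_symbol _ 1 0]; linear_combination c01
  have d11 : 2 * (G 0 1 z * covDeriv Γ V 1 0 z + G 1 1 z * covDeriv Γ V 1 1 z) = σ z * G 1 1 z := by
    simp only [covDeriv, h.symm_symbol _ 1 0]; linear_combination c11
  clear c00 c01 c11
  rw [e00, e01] at d00 d01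
  generalize twist G Γ V z = t at *
  generalize dilation G Γ V z = a at *
  have hs : σ z = 2 * a := by
    have : G 0 0 z * (σ z - 2 * a) = 0 := by linear_combination - d00
    linarith [(mul_eq_zero.1 this).resolve_left p0.ne']
  rw [hs] at d01 d11
  have e10 : covDeriv Γ V 1 0 z = - t * G 1 1 z := by
    have : (G 0 0 z * G 1 1 z - G 0 1 z * G 0 1 z) * (covDeriv Γ V 1 0 z + t * G 1 1 z) = 0 := by
      linear_combination G 1 1 z * d01 - G 0 1 z / 2 * d11
    linarith [(mul_eq_zero.1 this).resolve_left pd.ne']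
  refine ⟨e00, e01, e10, ?_⟩
  rw [e10] at d11
  have : G 1 1 z * (covDeriv Γ V 1 1 z - (a + t * G 0 1 z)) = 0 := by linear_combination d11 / 2
  linarith [(mul_eq_zero.1 this).resolve_left p1.ne']

lemma contDiffAt_covDeriv (h : IsLeviCivitaNear G Γ y) (hV : ∀ i, ContDiffAt ℝ ∞ (V i) y)
    (i j : Fin 2) : ContDiffAt ℝ ∞ (covDeriv Γ V i j) y := by
  have h1 := h.smooth_symbol
  have h2 := contDiffAt_partialDeriv i (hV j)
  unfold covDeriv
  fun_prop

lemma contDiffAt_twist (h : IsLeviCivitaNear G Γ y) (hV : ∀ i, ContDiffAt ℝ ∞ (V i) y) :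
    ContDiffAt ℝ ∞ (twist G Γ V) y :=
  (contDiffAt_covDeriv h hV 0 1).mul ((h.smooth 0 0).inv h.pos.self_of_nhds.1.ne')

lemma contDiffAt_dilation (h : IsLeviCivitaNear G Γ y) (hV : ∀ i, ContDiffAt ℝ ∞ (V i) y) :
    ContDiffAt ℝ ∞ (dilation G Γ V) y :=
  (contDiffAt_covDeriv h hV 0 0).add ((contDiffAt_twist h hV).mul (h.smooth 0 1))

end Conformal

/-! ### The Bochner formula -/

section Bochner

variable {G : Fin 2 → Fin 2 → EuclideanSpace ℝ (Fin 2) → ℝ}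
  {Γ : Fin 2 → Fin 2 → Fin 2 → EuclideanSpace ℝ (Fin 2) → ℝ}
  {V : Fin 2 → EuclideanSpace ℝ (Fin 2) → ℝ}
  {y : EuclideanSpace ℝ (Fin 2)}

/-- The Ricci identity for a conformal field: the commutator of second covariant derivatives
determines the derivatives of the dilation and of the twist up to the term `Ric(V, V)`. -/
lemma IsLeviCivitaNear.dilation_twist (h : IsLeviCivitaNear G Γ y)
    (hV : ∀ i, ContDiffAt ℝ ∞ (V i) y) {σ : EuclideanSpace ℝ (Fin 2) → ℝ}
    (hconf : ∀ᶠ z in 𝓝 y, ∀ i j, lieOf G V i j z = σ z * G i j z) :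
    V 0 y * partialDeriv 0 (dilation G Γ V) y + V 1 y * partialDeriv 1 (dilation G Γ V) y
      + (G 0 1 y * V 0 y + G 1 1 y * V 1 y) *
        (partialDeriv 0 (twist G Γ V) y + twist G Γ V y * (Γ 0 0 0 y + Γ 1 1 0 y))
      - (G 0 0 y * V 0 y + G 0 1 y * V 1 y) *
        (partialDeriv 1 (twist G Γ V) y + twist G Γ V y * (Γ 0 0 1 y + Γ 1 1 1 y))
    = - ∑ i, ∑ j, ricciOf Γ i j y * V i y * V j y := by
  have hB := h.covDeriv_eq hconf
  have hA := (contDiffAt_dilation h hV).differentiableAt (by simp)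
  have hT := (contDiffAt_twist h hV).differentiableAt (by simp)
  generalize dilation G Γ V = A at *
  generalize twist G Γ V = T at *
  have hG : ∀ i j, DifferentiableAt ℝ (G i j) y := fun i j => (h.smooth i j).differentiableAt (by simp)
  have hΓ : ∀ k i j, DifferentiableAt ℝ (Γ k i j) y :=
    fun k i j => (h.smooth_symbol k i j).differentiableAt (by simp)
  have hVd : ∀ i, DifferentiableAt ℝ (V i) y := fun i => (hV i).differentiableAt (by simp)
  have hVdd : ∀ i j, DifferentiableAt ℝ (partialDeriv j (V i)) y :=
    fun i j => (contDiffAt_partialDeriv j (hV i)).differentiableAt (by simp)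
  have dB : ∀ k i j, partialDeriv k (covDeriv Γ V i j) y = partialDeriv k (partialDeriv i (V j)) y
      + ((Γ j i 0 y * partialDeriv k (V 0) y + V 0 y * partialDeriv k (Γ j i 0) y) +
        (Γ j i 1 y * partialDeriv k (V 1) y + V 1 y * partialDeriv k (Γ j i 1) y)) := by
    intro k i j
    unfold covDeriv
    rw [partialDeriv_add _ (hVdd _ _) (by fun_prop), partialDeriv_add _ (by fun_prop) (by fun_prop),
      partialDeriv_mul _ (by fun_prop) (by fun_prop), partialDeriv_mul _ (by fun_prop) (by fun_prop)]
  have hc : ∀ k i j, partialDeriv k (G i j) y =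
      G 0 j y * Γ 0 k i y + G i 0 y * Γ 0 k j y + (G 1 j y * Γ 1 k i y + G i 1 y * Γ 1 k j y) := by
    intro k i j
    simpa [Fin.sum_univ_two] using (h.compat k i j).self_of_nhds
  -- the four components of `∇V` differentiated once more
  have e00 : partialDeriv 1 (covDeriv Γ V 0 0) y = partialDeriv 1 A y
      - (T y * partialDeriv 1 (G 0 1) y + G 0 1 y * partialDeriv 1 T y) := by
    rw [partialDeriv_congr 1 (hB.mono fun z hz => hz.1), partialDeriv_sub _ hA (by fun_prop),
      partialDeriv_mul _ hT (hG _ _)]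
  have e01 : partialDeriv 1 (covDeriv Γ V 0 1) y =
      T y * partialDeriv 1 (G 0 0) y + G 0 0 y * partialDeriv 1 T y := by
    rw [partialDeriv_congr 1 (hB.mono fun z hz => hz.2.1), partialDeriv_mul _ hT (hG _ _)]
  have e10 : partialDeriv 0 (covDeriv Γ V 1 0) y =
      -(T y * partialDeriv 0 (G 1 1) y + G 1 1 y * partialDeriv 0 T y) := by
    rw [partialDeriv_congr 0 (hB.mono fun z hz => hz.2.2.1), partialDeriv_mul _ (by fun_prop) (hG _ _),
      partialDeriv_neg]
    ring
  have e11 : partialDeriv 0 (covDeriv Γ V 1 1) y = partialDeriv 0 A y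
      + (T y * partialDeriv 0 (G 0 1) y + G 0 1 y * partialDeriv 0 T y) := by
    rw [partialDeriv_congr 0 (hB.mono fun z hz => hz.2.2.2), partialDeriv_add _ hA (by fun_prop),
      partialDeriv_mul _ hT (hG _ _)]
  obtain ⟨b00, b01, b10, b11⟩ := hB.self_of_nhds
  rw [dB] at e00 e01 e10 e11
  rw [partialDeriv_comm 1 0 (hV _)] at e00 e01
  simp only [hc] at e00 e01 e10 e11
  obtain ⟨r00, r01, r10, r11⟩ := ricciOf_eq_curvature (y := y) h.symm_symbol
  simp only [Fin.sum_univ_two, r00, r01, r10, r11]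
  simp only [covDeriv] at b00 b01 b10 b11
  have b00' := eq_sub_of_add_eq b00
  have b01' := eq_sub_of_add_eq b01
  have b10' := eq_sub_of_add_eq b10
  have b11' := eq_sub_of_add_eq b11
  simp only [b00', b01', b10', b11', h.symm_symbol _ 1 0, h.symm 1 0] at e00 e01 e10 e11
  simp only [curvature, Fin.sum_univ_two, h.symm_symbol _ 1 0]
  linear_combination V 1 y * (e10 - e00) - V 0 y * (e11 - e01)

lemma contDiffAt_gramDet (hG : ∀ i j, ContDiffAt ℝ ∞ (G i j) y) : ContDiffAt ℝ ∞ (gramDet G) y := by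
  unfold gramDet
  fun_prop

lemma contDiffAt_normSq (hG : ∀ i j, ContDiffAt ℝ ∞ (G i j) y)
    (hV : ∀ i, ContDiffAt ℝ ∞ (V i) y) : ContDiffAt ℝ ∞ (normSq G V) y := by
  unfold normSq
  fun_prop

lemma contDiffAt_rotated (hG : ∀ i j, ContDiffAt ℝ ∞ (G i j) y)
    (hd : 0 < gramDet G y) (hV : ∀ i, ContDiffAt ℝ ∞ (V i) y) (i : Fin 2) :
    ContDiffAt ℝ ∞ (rotated G V i) y := by
  have hs : ContDiffAt ℝ ∞ (fun z => (√(gramDet G z))⁻¹) y :=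
    ((contDiffAt_gramDet hG).sqrt hd.ne').inv (Real.sqrt_pos.2 hd).ne'
  fin_cases i <;> simp only [rotated] <;> exact ContDiffAt.mul (by fun_prop) hs

lemma partialDeriv_normSq (hG : ∀ i j, DifferentiableAt ℝ (G i j) y)
    (hV : ∀ i, DifferentiableAt ℝ (V i) y) (k : Fin 2) :
    partialDeriv k (normSq G V) y =
      partialDeriv k (G 0 0) y * (V 0 y * V 0 y) + 2 * (partialDeriv k (G 0 1) y * (V 0 y * V 1 y))
      + partialDeriv k (G 1 1) y * (V 1 y * V 1 y)
      + 2 * ((G 0 0 y * V 0 y + G 0 1 y * V 1 y) * partialDeriv k (V 0) y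
        + (G 0 1 y * V 0 y + G 1 1 y * V 1 y) * partialDeriv k (V 1) y) := by
  unfold normSq
  rw [partialDeriv_add _ (by fun_prop) (by fun_prop), partialDeriv_add _ (by fun_prop) (by fun_prop),
    partialDeriv_const_mul _ _ (by fun_prop),
    partialDeriv_mul _ (hG 0 0) (by fun_prop), partialDeriv_mul _ (hG 0 1) (by fun_prop),
    partialDeriv_mul _ (hG 1 1) (by fun_prop), partialDeriv_mul _ (hV 0) (hV 0),
    partialDeriv_mul _ (hV 0) (hV 1), partialDeriv_mul _ (hV 1) (hV 1)]
  ring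

lemma partialDeriv_gramDet (hG : ∀ i j, DifferentiableAt ℝ (G i j) y) (k : Fin 2) :
    partialDeriv k (gramDet G) y = G 0 0 y * partialDeriv k (G 1 1) y +
      G 1 1 y * partialDeriv k (G 0 0) y - 2 * (G 0 1 y * partialDeriv k (G 0 1) y) := by
  unfold gramDet
  rw [partialDeriv_sub _ (by fun_prop) (by fun_prop), partialDeriv_mul _ (hG _ _) (hG _ _),
    partialDeriv_mul _ (hG _ _) (hG _ _)]
  ring

lemma dirDeriv_congr {f f' : EuclideanSpace ℝ (Fin 2) → ℝ} (X : Fin 2 → EuclideanSpace ℝ (Fin 2) → ℝ)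
    (hf : ∀ᶠ z in 𝓝 y, f z = f' z) : dirDeriv X f y = dirDeriv X f' y := by
  simp [dirDeriv, partialDeriv_congr _ hf]

lemma eventually_contDiffAt_one {f : EuclideanSpace ℝ (Fin 2) → ℝ} (hf : ContDiffAt ℝ ∞ f y) :
    ∀ᶠ z in 𝓝 y, ContDiffAt ℝ 1 f z :=
  (hf.of_le (by exact_mod_cast le_top)).eventually (by simp)

/-- The Bochner formula for a conformal field `V` on a surface, in the frame formed by `V` and the
rotated field: the Laplacian of `log |V|²` is `-2 K`. -/
lemma IsLeviCivitaNear.bochner (h : IsLeviCivitaNear G Γ y)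
    (hV : ∀ i, ContDiffAt ℝ ∞ (V i) y) {σ : EuclideanSpace ℝ (Fin 2) → ℝ}
    (hconf : ∀ᶠ z in 𝓝 y, ∀ i j, lieOf G V i j z = σ z * G i j z) (h0 : V 0 y ≠ 0 ∨ V 1 y ≠ 0) :
    dirDeriv V (dirDeriv V fun z => Real.log (normSq G V z)) y +
      dirDeriv (rotated G V) (dirDeriv (rotated G V) fun z => Real.log (normSq G V z)) y =
    - 2 * ∑ i, ∑ j, ricciOf Γ i j y * V i y * V j y := by
  have hdet : 0 < gramDet G y := h.pos.self_of_nhds.2.2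
  have hN : 0 < normSq G V y := normSq_pos h.pos.self_of_nhds.1 hdet h0
  have hNe : ∀ᶠ z in 𝓝 y, 0 < normSq G V z :=
    (contDiffAt_normSq h.smooth hV).continuousAt.eventually (lt_mem_nhds hN)
  have hGe : ∀ᶠ z in 𝓝 y, ∀ i j, ContDiffAt ℝ 1 (G i j) z := by
    simp only [eventually_all]
    exact fun i j => eventually_contDiffAt_one (h.smooth i j)
  have hVe : ∀ᶠ z in 𝓝 y, ∀ i, ContDiffAt ℝ 1 (V i) z := by
    simp only [eventually_all]
    exact fun i => eventually_contDiffAt_one (hV i)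
  have hcompat := h.compat
  simp only [← eventually_all] at hcompat
  have hlog : ∀ᶠ z in 𝓝 y, ∀ k, partialDeriv k (fun z => Real.log (normSq G V z)) z =
      2 * ((G 0 0 z * V 0 z + G 0 1 z * V 1 z) * covDeriv Γ V k 0 z
        + (G 0 1 z * V 0 z + G 1 1 z * V 1 z) * covDeriv Γ V k 1 z) / normSq G V z := by
    filter_upwards [hNe, hGe, hVe, hcompat] with z hz hGz hVz hcz k
    have hGz' := fun i j => (hGz i j).differentiableAt one_ne_zero
    have hVz' := fun i => (hVz i).differentiableAt one_ne_zero
    rw [partialDeriv_log _ (by unfold normSq; fun_prop) hz.ne', partialDeriv_normSq hGz' hVz']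
    simp only [hcz, Fin.sum_univ_two, covDeriv, h.symm 1 0]
    ring
  have hVw : ∀ᶠ z in 𝓝 y, dirDeriv V (fun z => Real.log (normSq G V z)) z = 2 * dilation G Γ V z := by
    filter_upwards [hlog, h.covDeriv_eq hconf, hNe] with z hz hB hNz
    obtain ⟨b00, b01, b10, b11⟩ := hB
    simp only [dirDeriv, Fin.sum_univ_two, hz, b00, b01, b10, b11]
    field_simp
    unfold normSq
    ring
  have hWw : ∀ᶠ z in 𝓝 y, dirDeriv (rotated G V) (fun z => Real.log (normSq G V z)) z =
      -2 * (twist G Γ V z * √(gramDet G z)) := by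
    filter_upwards [hlog, h.covDeriv_eq hconf, hNe, h.pos] with z hz hB hNz hp
    obtain ⟨b00, b01, b10, b11⟩ := hB
    have hs : 0 < √(gramDet G z) := Real.sqrt_pos.2 hp.2.2
    have hs2 : √(gramDet G z) ^ 2 = gramDet G z := Real.sq_sqrt hp.2.2.le
    simp only [dirDeriv, Fin.sum_univ_two, hz, b00, b01, b10, b11, rotated, Matrix.cons_val_zero,
      Matrix.cons_val_one]
    field_simp
    rw [hs2]
    unfold normSq gramDet
    ring
  rw [dirDeriv_congr _ hVw, dirDeriv_congr _ hWw]
  have key := h.dilation_twist hV hconf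
  have hT := (contDiffAt_twist h hV).differentiableAt (by simp)
  have hA := (contDiffAt_dilation h hV).differentiableAt (by simp)
  have hG : ∀ i j, DifferentiableAt ℝ (G i j) y := fun i j => (h.smooth i j).differentiableAt (by simp)
  have hD : DifferentiableAt ℝ (gramDet G) y := (contDiffAt_gramDet h.smooth).differentiableAt (by simp)
  have hs : 0 < √(gramDet G y) := Real.sqrt_pos.2 hdet
  have hs2 : √(gramDet G y) ^ 2 = gramDet G y := Real.sq_sqrt hdet.le
  have hdD : ∀ k, partialDeriv k (gramDet G) y = 2 * gramDet G y * (Γ 0 0 k y + Γ 1 1 k y) := by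
    intro k
    rw [partialDeriv_gramDet hG]
    simp only [fun k i j => (h.compat k i j).self_of_nhds, Fin.sum_univ_two, h.symm 1 0,
      h.symm_symbol _ _ k, gramDet]
    fin_cases k <;> simp [h.symm_symbol _ 1 0] <;> ring
  have hdT : ∀ k, partialDeriv k (fun z => -2 * (twist G Γ V z * √(gramDet G z))) y =
      -2 * √(gramDet G y) * (partialDeriv k (twist G Γ V) y
        + twist G Γ V y * (Γ 0 0 k y + Γ 1 1 k y)) := by
    intro k
    rw [partialDeriv_const_mul _ _ (hT.fun_mul (hD.sqrt hdet.ne')),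
      partialDeriv_mul _ hT (hD.sqrt hdet.ne'), partialDeriv_sqrt _ hD hdet.ne', hdD]
    field_simp
    rw [hs2]
    ring
  simp only [dirDeriv, Fin.sum_univ_two, partialDeriv_const_mul _ _ hA, hdT, rotated,
    Matrix.cons_val_zero, Matrix.cons_val_one] at key ⊢
  field_simp
  linear_combination key

end Bochner

/-! ### Maximum principles in the plane -/

section MaximumPrinciple

variable {X : Fin 2 → EuclideanSpace ℝ (Fin 2) → ℝ} {f : EuclideanSpace ℝ (Fin 2) → ℝ}
  {y : EuclideanSpace ℝ (Fin 2)}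

lemma dirDeriv_dirDeriv_nonpos (hf : ContDiffAt ℝ ∞ f y) (hX : ∀ i, ContDiffAt ℝ ∞ (X i) y)
    (hmax : IsLocalMax f y) : dirDeriv X (dirDeriv X f) y ≤ 0 := by
  have hXd : ∀ i, DifferentiableAt ℝ (X i) y := fun i => (hX i).differentiableAt (by simp)
  have hfd : ∀ i, DifferentiableAt ℝ (partialDeriv i f) y :=
    fun i => (contDiffAt_partialDeriv i hf).differentiableAt (by simp)
  have hcrit : ∀ i, partialDeriv i f y = 0 := fun i => by
    simp [partialDeriv, hmax.fderiv_eq_zero]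
  set v : EuclideanSpace ℝ (Fin 2) := WithLp.toLp 2 fun i => X i y with hv
  have hvi : ∀ i, v i = X i y := fun i => rfl
  have hexp : dirDeriv X (dirDeriv X f) y = ∑ j, X j y * fderiv ℝ (partialDeriv j f) y v := by
    simp only [fderiv_eq_sum_partialDeriv, hvi]
    unfold dirDeriv
    simp only [Fin.sum_univ_two]
    have h0 := (hXd 0).fun_mul (hfd 0)
    have h1 := (hXd 1).fun_mul (hfd 1)
    simp only [fun k => partialDeriv_add k h0 h1, fun k => partialDeriv_mul k (hXd 0) (hfd 0),
      fun k => partialDeriv_mul k (hXd 1) (hfd 1), hcrit]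
    ring
  have hline : ∀ t : ℝ, HasDerivAt (fun t : ℝ => y + t • v) v t := fun t => by
    simpa using ((hasDerivAt_id t).smul_const v).const_add y
  have hcont : Tendsto (fun t : ℝ => y + t • v) (𝓝 0) (𝓝 y) := by
    have := (hline 0).continuousAt.tendsto
    simpa using this
  have hd1 : ∀ᶠ t in 𝓝 (0 : ℝ), deriv (fun t : ℝ => f (y + t • v)) t =
      ∑ j, X j y * partialDeriv j f (y + t • v) := by
    filter_upwards [hcont.eventually (eventually_contDiffAt_one hf)] with t ht
    have := (ht.differentiableAt one_ne_zero).hasFDerivAt.comp_hasDerivAt t (hline t)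
    rw [show (fun t : ℝ => f (y + t • v)) = f ∘ fun t : ℝ => y + t • v from rfl, this.deriv,
      fderiv_eq_sum_partialDeriv]
  have hd2 : deriv (deriv fun t : ℝ => f (y + t • v)) 0 = dirDeriv X (dirDeriv X f) y := by
    rw [EventuallyEq.deriv_eq hd1, hexp]
    refine HasDerivAt.deriv (HasDerivAt.fun_sum fun j _ => HasDerivAt.const_mul _ ?_)
    have hy : y + (0 : ℝ) • v = y := by simp
    have h1 : HasFDerivAt (partialDeriv j f) (fderiv ℝ (partialDeriv j f) y) (y + (0 : ℝ) • v) := by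
      rw [hy]; exact (hfd j).hasFDerivAt
    exact h1.comp_hasDerivAt (0 : ℝ) (hline 0)
  by_contra! hpos
  have hmax' : IsLocalMax (fun t : ℝ => f (y + t • v)) 0 := by
    have : ∀ᶠ t in 𝓝 (0 : ℝ), f (y + t • v) ≤ f y := hcont.eventually hmax
    simpa [IsLocalMax, IsMaxFilter] using this
  have hmin : IsLocalMin (fun t : ℝ => f (y + t • v)) 0 := by
    refine isLocalMin_of_deriv_deriv_pos (by rw [hd2]; exact hpos) ?_ ?_
    · rw [Eventually.self_of_nhds hd1]; simp [hcrit]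
    · exact ContinuousAt.comp (f := fun t : ℝ => y + t • v) (by simpa using hf.continuousAt)
        (hline 0).continuousAt
  have hconst : (fun t : ℝ => f (y + t • v)) =ᶠ[𝓝 0] fun _ => f y := by
    filter_upwards [hmax', hmin] with t h1 h2
    simp only [zero_smul, add_zero] at h1 h2
    exact le_antisymm h1 h2
  rw [← hd2, hconst.deriv.deriv_eq] at hpos
  simp at hpos

/-- The Laplacian of a function on the Euclidean plane. -/
noncomputable def planeLaplacian (f : EuclideanSpace ℝ (Fin 2) → ℝ) (y : EuclideanSpace ℝ (Fin 2)) :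
    ℝ :=
  partialDeriv 0 (partialDeriv 0 f) y + partialDeriv 1 (partialDeriv 1 f) y

/-- The function `1 / r²`, with `r` the distance to `p`. -/
noncomputable def barrier (p y : EuclideanSpace ℝ (Fin 2)) : ℝ :=
  ((y 0 - p 0) * (y 0 - p 0) + (y 1 - p 1) * (y 1 - p 1))⁻¹

lemma barrier_eq (p y : EuclideanSpace ℝ (Fin 2)) : barrier p y = (‖y - p‖ ^ 2)⁻¹ := by
  rw [barrier, EuclideanSpace.norm_sq_eq]
  simp [sq]

lemma sq_add_sq_ne_zero {p y : EuclideanSpace ℝ (Fin 2)} (h : y ≠ p) :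
    (y 0 - p 0) * (y 0 - p 0) + (y 1 - p 1) * (y 1 - p 1) ≠ 0 := by
  have h1 : ‖y - p‖ ^ 2 ≠ 0 := by simpa [sub_eq_zero] using h
  rw [EuclideanSpace.norm_sq_eq] at h1
  simpa [sq] using h1

lemma contDiff_coord (i : Fin 2) : ContDiff ℝ ∞ fun z : EuclideanSpace ℝ (Fin 2) => z i :=
  (EuclideanSpace.proj (𝕜 := ℝ) i).contDiff

lemma partialDeriv_coord (k i : Fin 2) (c : ℝ) :
    partialDeriv k (fun z => z i - c) y = if i = k then 1 else 0 := by
  have : HasFDerivAt (fun z : EuclideanSpace ℝ (Fin 2) => z i - c)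
      (EuclideanSpace.proj (𝕜 := ℝ) i) y := (EuclideanSpace.proj (𝕜 := ℝ) i).hasFDerivAt.sub_const c
  simp [partialDeriv, this.fderiv]

lemma contDiffAt_barrier {p : EuclideanSpace ℝ (Fin 2)} (h : y ≠ p) :
    ContDiffAt ℝ ∞ (barrier p) y := by
  have := fun i => (contDiff_coord i).contDiffAt (x := y)
  exact ContDiffAt.inv (by fun_prop) (sq_add_sq_ne_zero h)

lemma partialDeriv_barrier {p : EuclideanSpace ℝ (Fin 2)} (h : y ≠ p) (k : Fin 2) :
    partialDeriv k (barrier p) y = -2 * ((y k - p k) * (barrier p y * barrier p y)) := by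
  have hc : ∀ i, DifferentiableAt ℝ (fun z : EuclideanSpace ℝ (Fin 2) => z i - p i) y := fun i =>
    ((contDiff_coord i).differentiable (by simp)).differentiableAt.sub_const _
  unfold barrier
  rw [partialDeriv_inv _ ((hc 0).fun_mul (hc 0) |>.fun_add ((hc 1).fun_mul (hc 1)))
    (sq_add_sq_ne_zero h),
    partialDeriv_add _ ((hc 0).fun_mul (hc 0)) ((hc 1).fun_mul (hc 1)),
    partialDeriv_mul _ (hc 0) (hc 0), partialDeriv_mul _ (hc 1) (hc 1)]
  simp only [partialDeriv_coord]
  have := sq_add_sq_ne_zero h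
  fin_cases k <;> simp <;> field_simp <;> ring

lemma planeLaplacian_barrier {p : EuclideanSpace ℝ (Fin 2)} (h : y ≠ p) :
    0 < planeLaplacian (barrier p) y := by
  have hc : ∀ i, DifferentiableAt ℝ (fun z : EuclideanSpace ℝ (Fin 2) => z i - p i) y := fun i =>
    ((contDiff_coord i).differentiable (by simp)).differentiableAt.sub_const _
  have hb : DifferentiableAt ℝ (barrier p) y := (contDiffAt_barrier h).differentiableAt (by simp)
  have hk : ∀ k, partialDeriv k (partialDeriv k (barrier p)) y =
      -2 * (barrier p y * barrier p y) + 8 * (y k - p k) ^ 2 * barrier p y ^ 3 := by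
    intro k
    have he : ∀ᶠ z in 𝓝 y, partialDeriv k (barrier p) z =
        -2 * ((z k - p k) * (barrier p z * barrier p z)) := by
      filter_upwards [isOpen_ne.mem_nhds h] with z hz
      exact partialDeriv_barrier hz k
    rw [partialDeriv_congr k he, partialDeriv_const_mul _ _ ((hc k).fun_mul (hb.fun_mul hb)),
      partialDeriv_mul _ (hc k) (hb.fun_mul hb), partialDeriv_mul _ hb hb, partialDeriv_coord,
      partialDeriv_barrier h]
    simp
    ring
  have hq := sq_add_sq_ne_zero h
  have : planeLaplacian (barrier p) y = 4 * barrier p y ^ 2 := by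
    have hb1 : ((y 0 - p 0) * (y 0 - p 0) + (y 1 - p 1) * (y 1 - p 1)) * barrier p y = 1 :=
      mul_inv_cancel₀ hq
    rw [planeLaplacian, hk, hk]
    linear_combination 8 * barrier p y ^ 2 * hb1
  rw [this]
  have : barrier p y ≠ 0 := inv_ne_zero hq
  positivity

/-- The strong maximum principle, for functions which are subharmonic in the viscosity sense. -/
theorem eq_of_isMax_of_viscosity_subharmonic {u : EuclideanSpace ℝ (Fin 2) → ℝ}
    {c : EuclideanSpace ℝ (Fin 2)} {R : ℝ} (hu : ContinuousOn u (Metric.ball c (4 * R)))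
    (hmax : ∀ z ∈ Metric.ball c (4 * R), u z ≤ u c)
    (hsub : ∀ z ∈ Metric.ball c (4 * R), ∀ H : EuclideanSpace ℝ (Fin 2) → ℝ, ContDiffAt ℝ ∞ H z →
      0 < planeLaplacian H z → ¬ IsLocalMax (fun x => u x + H x) z) :
    ∀ z ∈ Metric.ball c R, u z = u c := by
  intro z₁ hz₁
  by_contra hne
  have hd : dist z₁ c < R := hz₁
  have hR : 0 < R := dist_nonneg.trans_lt hd
  -- `q` is a point of the contact set `u = u c` closest to `z₁`
  have hK : IsCompact (Metric.closedBall c (2 * R) ∩ u ⁻¹' {u c}) := by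
    refine (isCompact_closedBall c (2 * R)).of_isClosed_subset ?_ Set.inter_subset_left
    exact (hu.mono (Metric.closedBall_subset_ball (by linarith))).preimage_isClosed_of_isClosed
      Metric.isClosed_closedBall isClosed_singleton
  obtain ⟨q, ⟨hq2, hqu⟩, hqmin⟩ := hK.exists_isMinOn ⟨c, by simp [hR.le], rfl⟩
    (Continuous.continuousOn (f := fun z => dist z z₁) (by fun_prop))
  have hqu' : u q = u c := hqu
  have hqmin' : ∀ z, dist z c ≤ 2 * R → u z = u c → dist q z₁ ≤ dist z z₁ :=
    fun z hz hzu => hqmin ⟨hz, hzu⟩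
  set r := dist q z₁ with hr
  have hrpos : 0 < r := by
    refine dist_pos.2 ?_
    rintro rfl
    exact hne hqu'
  have hrR : r < R := (hqmin' c (by simp [hR.le]) rfl).trans_lt (by rwa [dist_comm])
  have hqc : dist q c < 2 * R := by linarith [dist_triangle q z₁ c]
  -- the barrier is centred at the midpoint `p`, so that the sphere of radius `r / 2` touches at `q`
  set p := midpoint ℝ z₁ q with hp
  have hqp : ‖q - p‖ = r / 2 := by
    rw [← dist_eq_norm, hp, dist_right_midpoint, hr, dist_comm]
    simp; ring
  have hpz : q - p = p - z₁ := by
    rw [hp, midpoint_eq_smul_add]; simp only [invOf_eq_inv]; module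
  have hinside : ∀ z, ‖z - p‖ ≤ r / 2 → z ≠ q → dist z z₁ < r := by
    intro z hz hzq
    have hpar := parallelogram_law_with_norm ℝ (z - p) (q - p)
    have e1 : z - p + (q - p) = z - z₁ := by rw [hpz]; abel
    have e2 : z - p - (q - p) = z - q := by abel
    rw [e1, e2, hqp] at hpar
    have : 0 < ‖z - q‖ := norm_pos_iff.2 (sub_ne_zero.2 hzq)
    rw [dist_eq_norm]
    nlinarith [norm_nonneg (z - p), norm_nonneg (z - z₁)]
  have hfar : ∀ z ∈ Metric.closedBall q (r / 4), r / 4 ≤ ‖z - p‖ := by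
    intro z hz
    rw [Metric.mem_closedBall, dist_eq_norm] at hz
    have : ‖q - p‖ ≤ ‖z - q‖ + ‖z - p‖ := by
      rw [norm_sub_rev z q]; simpa using norm_add_le (q - z) (z - p)
    linarith
  have hnep : ∀ z ∈ Metric.closedBall q (r / 4), z ≠ p := by
    intro z hz h
    have := hfar z hz
    rw [h] at this
    simp at this
    linarith
  have hball : Metric.closedBall q (r / 4) ⊆ Metric.ball c (4 * R) := by
    intro z hz
    have h1 : dist z q ≤ r / 4 := hz
    have := dist_triangle z q c
    rw [Metric.mem_ball]; linarith
  have hucont := hu.mono hball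
  have hbcont : ContinuousOn (barrier p) (Metric.closedBall q (r / 4)) :=
    fun z hz => (contDiffAt_barrier (hnep z hz)).continuousAt.continuousWithinAt
  obtain ⟨δ, hδ, hδu⟩ : ∃ δ > 0, ∀ z ∈ Metric.sphere q (r / 4) ∩ Metric.closedBall p (r / 2),
      u z ≤ u c - δ := by
    have hE : IsCompact (Metric.sphere q (r / 4) ∩ Metric.closedBall p (r / 2)) :=
      (isCompact_sphere _ _).inter_right Metric.isClosed_closedBall
    rcases (Metric.sphere q (r / 4) ∩ Metric.closedBall p (r / 2)).eq_empty_or_nonempty with h | h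
    · exact ⟨1, one_pos, by simp [h]⟩
    · obtain ⟨x, ⟨hxs, hxp⟩, hx⟩ := hE.exists_isMaxOn h
        (hucont.mono (Set.inter_subset_left.trans Metric.sphere_subset_closedBall))
      refine ⟨u c - u x, ?_, fun z hz => by have : u z ≤ u x := hx hz; linarith⟩
      have hxq : x ≠ q := by
        rintro rfl
        simp at hxs; linarith
      have hxz : dist x z₁ < r := hinside x (by simpa [dist_eq_norm] using hxp) hxq
      have hxc : dist x c ≤ 2 * R := by linarith [dist_triangle x z₁ c]
      have h1 : u x ≠ u c := fun h => (hqmin' x hxc h).not_gt hxz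
      have h2 := hmax x (hball (Metric.sphere_subset_closedBall hxs))
      exact sub_pos.2 (lt_of_le_of_ne h2 h1)
  set ε := δ * r ^ 2 / 32 with hε
  have hεpos : 0 < ε := by positivity
  have hbound : ∀ z ∈ Metric.sphere q (r / 4), u z + ε * barrier p z < u c + ε * barrier p q := by
    intro z hz
    have hzcl := Metric.sphere_subset_closedBall hz
    rw [barrier_eq, barrier_eq, hqp]
    by_cases hzp : ‖z - p‖ ≤ r / 2
    · have h1 := hδu z ⟨hz, by simpa [dist_eq_norm] using hzp⟩
      have h2 : (‖z - p‖ ^ 2)⁻¹ ≤ ((r / 4) ^ 2)⁻¹ := by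
        gcongr
        exact hfar z hzcl
      have h3 : ε * (‖z - p‖ ^ 2)⁻¹ ≤ δ / 2 := by
        calc ε * (‖z - p‖ ^ 2)⁻¹ ≤ ε * ((r / 4) ^ 2)⁻¹ := by gcongr
          _ = δ / 2 := by rw [hε]; field_simp; norm_num
      have h4 : 0 < ε * ((r / 2) ^ 2)⁻¹ := by positivity
      linarith
    · push Not at hzp
      have h1 := hmax z (hball hzcl)
      have h2 : (‖z - p‖ ^ 2)⁻¹ < ((r / 2) ^ 2)⁻¹ := by gcongr
      have h3 := mul_lt_mul_of_pos_left h2 hεpos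
      linarith
  obtain ⟨x, hx, hxmax⟩ := (isCompact_closedBall q (r / 4)).exists_isMaxOn
    ⟨q, by simp; positivity⟩ (hucont.add (hbcont.const_smul ε))
  have hxmax' : ∀ z ∈ Metric.closedBall q (r / 4),
      u z + ε * barrier p z ≤ u x + ε * barrier p x := fun z hz => hxmax hz
  have hxball : x ∈ Metric.ball q (r / 4) := by
    rcases (Metric.mem_closedBall.1 hx).lt_or_eq with h | h
    · exact h
    · have h1 := hbound x h
      have h2 := hxmax' q (by simp; positivity)
      rw [hqu'] at h2
      linarith
  refine hsub x (hball hx) (fun z => ε * barrier p z)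
    (contDiffAt_const.mul (contDiffAt_barrier (hnep x hx))) ?_ ?_
  · have hb := contDiffAt_barrier (hnep x hx)
    have he : ∀ k, ∀ᶠ z in 𝓝 x, partialDeriv k (fun z => ε * barrier p z) z =
        ε * partialDeriv k (barrier p) z := fun k => by
      filter_upwards [eventually_contDiffAt_one hb] with z hz
      exact partialDeriv_const_mul _ _ (hz.differentiableAt one_ne_zero)
    have : planeLaplacian (fun z => ε * barrier p z) x = ε * planeLaplacian (barrier p) x := by
      have hdd := fun k => (contDiffAt_partialDeriv k hb).differentiableAt (by simp)
      simp only [planeLaplacian, partialDeriv_congr _ (he _),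
        partialDeriv_const_mul _ _ (hdd _)]
      ring
    rw [this]
    exact mul_pos hεpos (planeLaplacian_barrier (hnep x hx))
  · filter_upwards [Metric.isOpen_ball.mem_nhds hxball] with z hz
    exact hxmax' z (Metric.ball_subset_closedBall hz)

end MaximumPrinciple

/-! ### The Laplacian in flat coordinates -/

section ChangeOfVariables

lemma partialDeriv_comp {m n : ℕ} {H : EuclideanSpace ℝ (Fin m) → ℝ}
    {F : EuclideanSpace ℝ (Fin n) → EuclideanSpace ℝ (Fin m)} {y : EuclideanSpace ℝ (Fin n)}
    (hH : DifferentiableAt ℝ H (F y)) (hF : DifferentiableAt ℝ F y) (k : Fin n) :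
    partialDeriv k (fun z => H (F z)) y =
      ∑ a, partialDeriv a H (F y) * partialDeriv k (fun z => F z a) y := by
  have h1 : fderiv ℝ (fun z => H (F z)) y = _ := fderiv_comp y hH hF
  have h2 : ∀ a, fderiv ℝ (fun z => F z a) y = _ := fun a =>
    ((EuclideanSpace.proj (𝕜 := ℝ) a).hasFDerivAt.comp y hF.hasFDerivAt).fderiv
  unfold partialDeriv
  rw [h1, ContinuousLinearMap.comp_apply, fderiv_eq_sum_partialDeriv]
  simp [h2, partialDeriv, mul_comm]

variable {F : EuclideanSpace ℝ (Fin 2) → EuclideanSpace ℝ (Fin 2)}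
  {H : EuclideanSpace ℝ (Fin 2) → ℝ} {y : EuclideanSpace ℝ (Fin 2)}
  {V W : Fin 2 → EuclideanSpace ℝ (Fin 2) → ℝ}

lemma dirDeriv_comp (hH : DifferentiableAt ℝ H (F y)) (hF : DifferentiableAt ℝ F y)
    (X : Fin 2 → EuclideanSpace ℝ (Fin 2) → ℝ) :
    dirDeriv X (fun z => H (F z)) y =
      ∑ a, partialDeriv a H (F y) * dirDeriv X (fun z => F z a) y := by
  simp only [dirDeriv, partialDeriv_comp hH hF, Fin.sum_univ_two]
  ring

/-- The Laplacian read in flat coordinates `F`, through a frame which is orthonormal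
up to the sign of its second vector. -/
lemma dirDeriv_dirDeriv_comp (hF : ContDiffAt ℝ ∞ F y) (hH : ContDiffAt ℝ ∞ H (F y))
    (hW : ∀ i, ContDiffAt ℝ ∞ (W i) y)
    (hV0 : ∀ᶠ z in 𝓝 y, dirDeriv V (fun x => F x 0) z = 1)
    (hV1 : ∀ᶠ z in 𝓝 y, dirDeriv V (fun x => F x 1) z = 0)
    (hW0 : ∀ᶠ z in 𝓝 y, dirDeriv W (fun x => F x 0) z = 0)
    (hW1 : ∀ᶠ z in 𝓝 y, dirDeriv W (fun x => F x 1) z ^ 2 = 1) :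
    dirDeriv V (dirDeriv V fun z => H (F z)) y + dirDeriv W (dirDeriv W fun z => H (F z)) y =
      planeLaplacian H (F y) := by
  have hFa : ∀ a, ContDiffAt ℝ ∞ (fun z => F z a) y := fun a =>
    (contDiff_coord a).contDiffAt.comp y hF
  have hFe : ∀ᶠ z in 𝓝 y, DifferentiableAt ℝ F z :=
    ((hF.of_le (by exact_mod_cast le_top : (1 : ℕ∞ω) ≤ ∞)).eventually (by simp)).mono
      fun z hz => hz.differentiableAt one_ne_zero
  have hHe : ∀ᶠ z in 𝓝 y, DifferentiableAt ℝ H (F z) :=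
    hF.continuousAt.eventually ((eventually_contDiffAt_one hH).mono
      fun z hz => hz.differentiableAt one_ne_zero)
  have hdH : ∀ a, DifferentiableAt ℝ (partialDeriv a H) (F y) := fun a =>
    (contDiffAt_partialDeriv a hH).differentiableAt (by simp)
  have hFd := hFe.self_of_nhds
  set η : EuclideanSpace ℝ (Fin 2) → ℝ := dirDeriv W fun x => F x 1 with hη
  have hηs : DifferentiableAt ℝ η y := by
    have h1 := fun i => (hW i).mul (contDiffAt_partialDeriv i (hFa 1))
    have : ContDiffAt ℝ ∞ η y := by
      rw [hη]; unfold dirDeriv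
      simp only [Fin.sum_univ_two]
      exact (h1 0).add (h1 1)
    exact this.differentiableAt (by simp)
  have hη2 : η y ^ 2 = 1 := hW1.self_of_nhds
  -- the sign `η` is locally constant
  have hηd : ∀ k, partialDeriv k η y = 0 := by
    intro k
    have h1 := partialDeriv_congr k (h := fun _ => 1) hW1
    simp only [sq] at h1
    rw [partialDeriv_mul _ hηs hηs] at h1
    have h2 : η y ≠ 0 := by rintro h; simp [h] at hη2
    have h3 : η y * partialDeriv k η y = 0 := by
      have h4 : partialDeriv k (fun _ : EuclideanSpace ℝ (Fin 2) => (1 : ℝ)) y = 0 := by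
        simp [partialDeriv]
      linarith
    exact (mul_eq_zero.1 h3).resolve_left h2
  have hVH : ∀ᶠ z in 𝓝 y, dirDeriv V (fun z => H (F z)) z = partialDeriv 0 H (F z) := by
    filter_upwards [hFe, hHe, hV0, hV1] with z h1 h2 h3 h4
    simp [dirDeriv_comp h2 h1, h3, h4]
  have hWH : ∀ᶠ z in 𝓝 y, dirDeriv W (fun z => H (F z)) z = η z * partialDeriv 1 H (F z) := by
    filter_upwards [hFe, hHe, hW0] with z h1 h2 h3
    simp [dirDeriv_comp h2 h1, h3, hη, mul_comm]
  have e1 : dirDeriv V (fun z => partialDeriv 0 H (F z)) y =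
      partialDeriv 0 (partialDeriv 0 H) (F y) := by
    simp [dirDeriv_comp (hdH 0) hFd, hV0.self_of_nhds, hV1.self_of_nhds]
  have e2 : dirDeriv W (fun z => η z * partialDeriv 1 H (F z)) y =
      η y * dirDeriv W (fun z => partialDeriv 1 H (F z)) y := by
    have := fun k => partialDeriv_mul k hηs ((hdH 1).comp y hFd)
    simp only [Function.comp_def] at this
    simp only [dirDeriv, Fin.sum_univ_two, this, hηd]
    ring
  have e3 : dirDeriv W (fun z => partialDeriv 1 H (F z)) y =
      η y * partialDeriv 1 (partialDeriv 1 H) (F y) := by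
    simp [dirDeriv_comp (hdH 1) hFd, hW0.self_of_nhds, hη, mul_comm]
  rw [dirDeriv_congr _ hVH, dirDeriv_congr _ hWH, e1, e2, e3, planeLaplacian]
  linear_combination partialDeriv 1 (partialDeriv 1 H) (F y) * hη2

end ChangeOfVariables

/-! ### The closed coframe of a conformal field -/

section FlatCoordinates

/-- The coframe `(g(V, ·), g(W, ·)) / |V|²` dual to `V` and the rotated field `W`. -/
noncomputable def coframe (G : Fin 2 → Fin 2 → EuclideanSpace ℝ (Fin 2) → ℝ)
    (V : Fin 2 → EuclideanSpace ℝ (Fin 2) → ℝ) : Fin 2 → Fin 2 → EuclideanSpace ℝ (Fin 2) → ℝ :=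
  ![![fun y => (G 0 0 y * V 0 y + G 0 1 y * V 1 y) * (normSq G V y)⁻¹,
      fun y => (G 0 1 y * V 0 y + G 1 1 y * V 1 y) * (normSq G V y)⁻¹],
    ![fun y => -(√(gramDet G y) * V 1 y) * (normSq G V y)⁻¹,
      fun y => √(gramDet G y) * V 0 y * (normSq G V y)⁻¹]]

variable {G : Fin 2 → Fin 2 → EuclideanSpace ℝ (Fin 2) → ℝ}
  {V : Fin 2 → EuclideanSpace ℝ (Fin 2) → ℝ} {y : EuclideanSpace ℝ (Fin 2)}

lemma contDiffAt_coframe (hG : ∀ i j, ContDiffAt ℝ ∞ (G i j) y)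
    (hd : 0 < gramDet G y) (hV : ∀ i, ContDiffAt ℝ ∞ (V i) y) (hN : 0 < normSq G V y) (a i : Fin 2) :
    ContDiffAt ℝ ∞ (coframe G V a i) y := by
  have hs := (contDiffAt_gramDet hG).sqrt hd.ne'
  have hNi := (contDiffAt_normSq hG hV).inv hN.ne'
  fin_cases a <;> fin_cases i <;> simp only [coframe] <;>
    exact ContDiffAt.mul (by fun_prop) hNi

/-- The coframe of a conformal field is closed. -/
lemma coframe_closed (hG : ∀ i j, DifferentiableAt ℝ (G i j) y) (hsymm : ∀ i j, G i j = G j i)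
    (hd : 0 < gramDet G y) (hV : ∀ i, DifferentiableAt ℝ (V i) y) (hN : 0 < normSq G V y)
    {s : ℝ} (hconf : ∀ i j, lieOf G V i j y = s * G i j y) (a : Fin 2) :
    partialDeriv 0 (coframe G V a 1) y = partialDeriv 1 (coframe G V a 0) y := by
  have hDd : DifferentiableAt ℝ (gramDet G) y := by unfold gramDet; fun_prop
  have hNd : DifferentiableAt ℝ (normSq G V) y := by unfold normSq; fun_prop
  have hs : DifferentiableAt ℝ (fun z => √(gramDet G z)) y := hDd.sqrt hd.ne'
  have hNi : DifferentiableAt ℝ (fun z => (normSq G V z)⁻¹) y := hNd.inv hN.ne'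
  have c00 := hconf 0 0
  have c01 := hconf 0 1
  have c11 := hconf 1 1
  simp only [lieOf, Fin.sum_univ_two, hsymm 1 0] at c00 c01 c11
  have hspos : 0 < √(gramDet G y) := Real.sqrt_pos.2 hd
  have hs2 : √(gramDet G y) ^ 2 = gramDet G y := Real.sq_sqrt hd.le
  fin_cases a <;> simp only [coframe, Fin.mk_zero, Fin.mk_one,
    Matrix.cons_val_zero, Matrix.cons_val_one]
  · rw [partialDeriv_mul _ (by fun_prop) hNi, partialDeriv_mul _ (by fun_prop) hNi,
      partialDeriv_inv _ hNd hN.ne', partialDeriv_inv _ hNd hN.ne',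
      partialDeriv_add _ (by fun_prop) (by fun_prop), partialDeriv_add _ (by fun_prop) (by fun_prop)]
    simp only [fun k i j l => partialDeriv_mul k (hG i j) (hV l)]
    rw [partialDeriv_normSq hG hV, partialDeriv_normSq hG hV]
    field_simp
    unfold normSq
    linear_combination
      ((G 0 0 y * V 0 y + G 0 1 y * V 1 y) * V 0 y - (G 0 1 y * V 0 y + G 1 1 y * V 1 y) * V 1 y) * c01
      + (G 0 0 y * V 0 y + G 0 1 y * V 1 y) * V 1 y * c11
      - (G 0 1 y * V 0 y + G 1 1 y * V 1 y) * V 0 y * c00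
  · rw [partialDeriv_mul _ (by fun_prop) hNi, partialDeriv_mul _ (by fun_prop) hNi,
      partialDeriv_inv _ hNd hN.ne', partialDeriv_inv _ hNd hN.ne', partialDeriv_neg,
      partialDeriv_mul _ hs (hV _), partialDeriv_mul _ hs (hV _), partialDeriv_sqrt _ hDd hd.ne',
      partialDeriv_sqrt _ hDd hd.ne', partialDeriv_normSq hG hV, partialDeriv_normSq hG hV,
      partialDeriv_gramDet hG, partialDeriv_gramDet hG]
    field_simp
    rw [hs2]
    unfold normSq gramDet
    linear_combination
      (G 0 0 y * (V 0 y * V 0 y) + 2 * (G 0 1 y * (V 0 y * V 1 y)) + G 1 1 y * (V 1 y * V 1 y)) *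
        (G 1 1 y * c00 - 2 * G 0 1 y * c01 + G 0 0 y * c11)
      - 2 * (G 0 0 y * G 1 1 y - G 0 1 y * G 0 1 y) *
        (V 0 y * V 0 y * c00 + 2 * V 0 y * V 1 y * c01 + V 1 y * V 1 y * c11)

/-- The Poincaré lemma for `1`-forms on a convex domain of the plane, in coordinates. -/
lemma exists_primitive {U : Set (EuclideanSpace ℝ (Fin 2))} (hU : IsOpen U) (hc : Convex ℝ U)
    {θ : Fin 2 → EuclideanSpace ℝ (Fin 2) → ℝ} (hθ : ∀ z ∈ U, ∀ i, ContDiffAt ℝ ∞ (θ i) z)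
    (hclosed : ∀ z ∈ U, partialDeriv 0 (θ 1) z = partialDeriv 1 (θ 0) z) :
    ∃ f : EuclideanSpace ℝ (Fin 2) → ℝ, ContDiffOn ℝ ∞ f U ∧
      ∀ z ∈ U, ∀ i, partialDeriv i f z = θ i z := by
  set P : Fin 2 → EuclideanSpace ℝ (Fin 2) →L[ℝ] ℝ := fun i => EuclideanSpace.proj i with hP
  set Ω : EuclideanSpace ℝ (Fin 2) → EuclideanSpace ℝ (Fin 2) →L[ℝ] ℝ := fun z =>
    θ 0 z • P 0 + θ 1 z • P 1 with hΩ
  have hΩs : ContDiffOn ℝ ∞ Ω U := fun z hz =>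
    (((hθ z hz 0).smul contDiffAt_const).add ((hθ z hz 1).smul contDiffAt_const)).contDiffWithinAt
  have hd : ∀ z ∈ U, ∀ i, DifferentiableAt ℝ (θ i) z := fun z hz i =>
    (hθ z hz i).differentiableAt (by simp)
  obtain ⟨f, hf⟩ := hc.exists_forall_hasFDerivAt_of_fderiv_symmetric hU
    (hΩs.differentiableOn (by simp)) (by
      intro z hz u v
      have h1 : HasFDerivAt Ω ((fderiv ℝ (θ 0) z).smulRight (P 0) +
          (fderiv ℝ (θ 1) z).smulRight (P 1)) z :=
        ((hd z hz 0).hasFDerivAt.smul_const (P 0)).add ((hd z hz 1).hasFDerivAt.smul_const (P 1))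
      have h2 : ∀ u v, fderiv ℝ Ω z u v =
          fderiv ℝ (θ 0) z u * v 0 + fderiv ℝ (θ 1) z u * v 1 := fun u v => by
        rw [h1.fderiv]; rfl
      rw [h2, h2]
      simp only [fderiv_eq_sum_partialDeriv, Fin.sum_univ_two, hclosed z hz]
      ring)
  refine ⟨f, ?_, ?_⟩
  · rw [contDiffOn_infty_iff_fderiv_of_isOpen hU]
    exact ⟨fun z hz => (hf z hz).differentiableAt.differentiableWithinAt,
      hΩs.congr fun z hz => (hf z hz).fderiv⟩
  · intro z hz i
    rw [partialDeriv, (hf z hz).fderiv]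
    fin_cases i <;> simp [hΩ, hP]

end FlatCoordinates

/-! ### Tensor components in charts -/

section Charts

variable {n : ℕ} {M : Type*} [TopologicalSpace M]
  [ChartedSpace (EuclideanSpace ℝ (Fin n)) M] [IsManifold (𝓡 n) ∞ M]
  {e e' : OpenPartialHomeomorph M (EuclideanSpace ℝ (Fin n))}
  {y : EuclideanSpace ℝ (Fin n)} {p : M}

lemma isManifold_one : IsManifold (𝓡 n) 1 M :=
  IsManifold.of_le (n := ∞) (by exact_mod_cast le_top)

lemma mdifferentiable_of_mem_maximalAtlas
    (he : e ∈ IsManifold.maximalAtlas (𝓡 n) ∞ M) : e.MDifferentiable (𝓡 n) (𝓡 n) :=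
  ⟨(contMDiffOn_of_mem_maximalAtlas he).mdifferentiableOn (by simp),
    (contMDiffOn_symm_of_mem_maximalAtlas he).mdifferentiableOn (by simp)⟩

lemma component_coordVector (he : e ∈ IsManifold.maximalAtlas (𝓡 n) ∞ M) (hy : y ∈ e.target)
    (i j : Fin n) : component e (e.symm y) (coordVector e i y) j = if j = i then 1 else 0 := by
  have h : mfderiv (𝓡 n) (𝓡 n) e (e.symm y) (coordVector e i y) = EuclideanSpace.single i (1 : ℝ) :=
    DFunLike.congr_fun ((mdifferentiable_of_mem_maximalAtlas he).comp_symm_deriv hy)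
      (EuclideanSpace.single i (1 : ℝ))
  rw [component, h]
  simp

lemma eq_sum_component (he : e ∈ IsManifold.maximalAtlas (𝓡 n) ∞ M) (hy : y ∈ e.target)
    (u : TangentSpace (𝓡 n) (e.symm y)) :
    u = ∑ i, component e (e.symm y) u i • coordVector e i y := by
  have h := (mdifferentiable_of_mem_maximalAtlas he).symm_comp_deriv (e.map_target hy)
  have h2 := DFunLike.congr_fun h u
  rw [ContinuousLinearMap.comp_apply, e.right_inv hy] at h2
  have h3 : ∀ w : EuclideanSpace ℝ (Fin n), w = ∑ i, w i • EuclideanSpace.single i (1 : ℝ) := by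
    intro w
    conv_lhs => rw [← (EuclideanSpace.basisFun (Fin n) ℝ).sum_repr w]
    simp
  let L : EuclideanSpace ℝ (Fin n) →L[ℝ] EuclideanSpace ℝ (Fin n) :=
    mfderiv (𝓡 n) (𝓡 n) e.symm y
  let w : EuclideanSpace ℝ (Fin n) := mfderiv (𝓡 n) (𝓡 n) e (e.symm y) u
  have h4 : L w = ∑ i, w i • L (EuclideanSpace.single i (1 : ℝ)) := by
    conv_lhs => rw [h3 w]
    simp only [map_sum, map_smul]
  exact h2.symm.trans h4

lemma exists_component_eq (he : e ∈ IsManifold.maximalAtlas (𝓡 n) ∞ M) (hp : p ∈ e.source)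
    (k : Fin n) : ∃ u : TangentSpace (𝓡 n) p, ∀ i, component e p u i = if i = k then 1 else 0 := by
  obtain ⟨u, hu⟩ := (mdifferentiable_of_mem_maximalAtlas he).mfderiv_surjective hp
    (EuclideanSpace.single k (1 : ℝ) : EuclideanSpace ℝ (Fin n))
  refine ⟨u, fun i => ?_⟩
  rw [component, hu]
  simp

lemma component_ne_zero (he : e ∈ IsManifold.maximalAtlas (𝓡 n) ∞ M) (hp : p ∈ e.source)
    {u : TangentSpace (𝓡 n) p} (hu : u ≠ 0) : ∃ i, component e p u i ≠ 0 := by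
  by_contra! h
  refine hu ((mdifferentiable_of_mem_maximalAtlas he).mfderiv_injective hp ?_)
  rw [map_zero]
  have : (mfderiv (𝓡 n) (𝓡 n) e p u : EuclideanSpace ℝ (Fin n)) = 0 := by
    refine PiLp.ext fun i => ?_
    exact h i
  exact this

/-- The metric in terms of components. -/
lemma inner_eq_sum (g : Metric n M) (he : e ∈ IsManifold.maximalAtlas (𝓡 n) ∞ M)
    (hp : p ∈ e.source) (u v : TangentSpace (𝓡 n) p) :
    g.inner p u v = ∑ i, ∑ j, gram g e (e p) i j * component e p u i * component e p v j := by
  obtain ⟨y, hy, rfl⟩ : ∃ y ∈ e.target, e.symm y = p := ⟨e p, e.map_source hp, e.left_inv hp⟩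
  rw [e.right_inv hy]
  conv_lhs => rw [eq_sum_component he hy u, eq_sum_component he hy v]
  simp only [map_sum, sum_apply, map_smul, smul_apply, gram,
    Matrix.of_apply, smul_eq_mul, Finset.mul_sum]
  rw [Finset.sum_comm]
  refine Finset.sum_congr rfl fun i _ => Finset.sum_congr rfl fun j _ => ?_
  ring

/-- The derivative of a map into a Euclidean space in terms of components. -/
lemma mfderiv_apply_eq_sum {m : ℕ} {Φ : M → EuclideanSpace ℝ (Fin m)}
    (he : e ∈ IsManifold.maximalAtlas (𝓡 n) ∞ M)
    (hp : p ∈ e.source) (hΦ : MDifferentiableAt (𝓡 n) (𝓡 m) Φ p) (u : TangentSpace (𝓡 n) p)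
    (a : Fin m) :
    EuclideanSpace.proj (𝕜 := ℝ) a (mfderiv (𝓡 n) (𝓡 m) Φ p u) =
      ∑ i, partialDeriv i (fun z => Φ (e.symm z) a) (e p) * component e p u i := by
  obtain ⟨y, hy, rfl⟩ : ∃ y ∈ e.target, e.symm y = p := ⟨e p, e.map_source hp, e.left_inv hp⟩
  rw [e.right_inv hy]
  have hs := (mdifferentiable_of_mem_maximalAtlas he).mdifferentiableAt_symm hy
  have hcomp := mfderiv_comp y hΦ hs
  rw [mfderiv_eq_fderiv] at hcomp
  have hd : DifferentiableAt ℝ (Φ ∘ e.symm) y := (hΦ.comp y hs).differentiableAt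
  have hpa : ∀ i, partialDeriv i (fun z => Φ (e.symm z) a) y =
      EuclideanSpace.proj (𝕜 := ℝ) a (mfderiv (𝓡 n) (𝓡 m) Φ (e.symm y) (coordVector e i y)) := by
    intro i
    have h1 : fderiv ℝ (fun z => Φ (e.symm z) a) y = _ :=
      ((EuclideanSpace.proj (𝕜 := ℝ) a).hasFDerivAt.comp y hd.hasFDerivAt).fderiv
    rw [partialDeriv, h1, hcomp]
    rfl
  let L : EuclideanSpace ℝ (Fin n) →L[ℝ] EuclideanSpace ℝ (Fin m) :=
    mfderiv (𝓡 n) (𝓡 m) Φ (e.symm y)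
  have h1 := congrArg (fun w => EuclideanSpace.proj (𝕜 := ℝ) a (L w)) (eq_sum_component he hy u)
  refine h1.trans ?_
  have h2 : ∀ w : Fin n → EuclideanSpace ℝ (Fin n), ∀ c : Fin n → ℝ,
      EuclideanSpace.proj (𝕜 := ℝ) a (L (∑ i, c i • w i)) =
        ∑ i, EuclideanSpace.proj (𝕜 := ℝ) a (L (w i)) * c i := by
    intro w c
    simp only [map_sum, map_smul, smul_eq_mul]
    exact Finset.sum_congr rfl fun i _ => mul_comm _ _
  simp only [hpa]
  exact h2 _ _

lemma contMDiffAt_coordVector (he : e ∈ IsManifold.maximalAtlas (𝓡 n) ∞ M) (hy : y ∈ e.target)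
    (i : Fin n) : ContMDiffAt (𝓡 n) (𝓡 n).tangent ∞
      (fun z => (⟨e.symm z, coordVector e i z⟩ : TangentBundle (𝓡 n) M)) y := by
  have := isManifold_one (n := n) (M := M)
  have h1 := (contMDiffOn_symm_of_mem_maximalAtlas he).contMDiffOn_tangentMapWithin
    (m := ∞) (by simp) e.open_target.uniqueMDiffOn
  have h2 : ContMDiff (𝓡 n) (𝓡 n).tangent ∞ (fun z : EuclideanSpace ℝ (Fin n) =>
      (⟨z, EuclideanSpace.single i (1 : ℝ)⟩ : TangentBundle (𝓡 n) (EuclideanSpace ℝ (Fin n)))) :=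
    contMDiff_vectorSpace_iff_contDiff.2 contDiff_const
  have h3 := h1.comp (s := e.target) h2.contMDiffOn fun z hz => hz
  refine (h3.congr fun z hz => ?_).contMDiffAt (e.open_target.mem_nhds hy)
  exact (tangentMapWithin_eq_tangentMap (p := ⟨z, EuclideanSpace.single i (1 : ℝ)⟩)
    (e.open_target.uniqueMDiffOn z hz)
    ((mdifferentiable_of_mem_maximalAtlas he).mdifferentiableAt_symm hz)).symm

lemma contDiffAt_gram (g : Metric n M) (he : e ∈ IsManifold.maximalAtlas (𝓡 n) ∞ M)
    (hy : y ∈ e.target) (i j : Fin n) : ContDiffAt ℝ ∞ (fun z => gram g e z i j) y := by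
  have : ContMDiffAt (𝓡 n) ((𝓡 n).prod 𝓘(ℝ)) ∞
      (fun z => Bundle.TotalSpace.mk' ℝ (E := Bundle.Trivial M ℝ) (e.symm z)
        (g.inner (e.symm z) (coordVector e i z) (coordVector e j z))) y := by
    apply ContMDiffAt.clm_bundle_apply₂ (F₁ := EuclideanSpace ℝ (Fin n))
      (F₂ := EuclideanSpace ℝ (Fin n))
    · exact g.contMDiff.contMDiffAt.comp y
        ((contMDiffOn_symm_of_mem_maximalAtlas he).contMDiffAt (e.open_target.mem_nhds hy))
    · exact contMDiffAt_coordVector he hy i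
    · exact contMDiffAt_coordVector he hy j
  rw [Bundle.contMDiffAt_totalSpace] at this
  exact this.2.contDiffAt

lemma contDiffAt_fieldCoord {V : (x : M) → TangentSpace (𝓡 n) x}
    (hV : ContMDiff (𝓡 n) (𝓡 n).tangent ∞ (fun x => (⟨x, V x⟩ : TangentBundle (𝓡 n) M)))
    (he : e ∈ IsManifold.maximalAtlas (𝓡 n) ∞ M) (hy : y ∈ e.target) (i : Fin n) :
    ContDiffAt ℝ ∞ (fieldCoord V e i) y := by
  have := isManifold_one (n := n) (M := M)
  have h1 := (contMDiffOn_of_mem_maximalAtlas he).contMDiffOn_tangentMapWithin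
    (m := ∞) (by simp) e.open_source.uniqueMDiffOn
  have h2 := h1.comp (s := e.source) hV.contMDiffOn fun z hz => hz
  have h3 := h2.comp (contMDiffOn_symm_of_mem_maximalAtlas he) fun z hz => e.map_target hz
  have h4 : ContMDiffAt (𝓡 n) (𝓡 n) ∞ _ y :=
    (contMDiff_snd_tangentBundle_modelSpace (EuclideanSpace ℝ (Fin n)) (𝓡 n)).contMDiffAt.comp y
      (h3.contMDiffAt (e.open_target.mem_nhds hy))
  have h5 := (EuclideanSpace.proj (𝕜 := ℝ) i).contDiff.contDiffAt.comp y h4.contDiffAt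
  refine h5.congr_of_eventuallyEq ?_
  filter_upwards [e.open_target.mem_nhds hy] with z hz
  simp only [fieldCoord, component, Function.comp_apply]
  have h6 := tangentMapWithin_eq_tangentMap
    (p := ⟨e.symm z, V (e.symm z)⟩) (e.open_source.uniqueMDiffOn _ (e.map_target hz))
    ((mdifferentiable_of_mem_maximalAtlas he).mdifferentiableAt (e.map_target hz))
  exact congrArg (fun w : TangentBundle (𝓡 n) (EuclideanSpace ℝ (Fin n)) =>
    EuclideanSpace.proj (𝕜 := ℝ) i (w.2 : EuclideanSpace ℝ (Fin n))) h6.symm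

lemma fieldCoord_apply (V : (x : M) → TangentSpace (𝓡 n) x) (hp : p ∈ e.source) (i : Fin n) :
    fieldCoord V e i (e p) = component e p (V p) i := by
  rw [fieldCoord, e.left_inv hp]

lemma gram_comm (g : Metric n M) (i j : Fin n) : gram g e y i j = gram g e y j i :=
  g.symm _ _ _

end Charts

/-! ### Metrics on surfaces -/

section Surface

variable {M : Type*} [TopologicalSpace M]
  [ChartedSpace (EuclideanSpace ℝ (Fin 2)) M] [IsManifold (𝓡 2) ∞ M]
  {e e' : OpenPartialHomeomorph M (EuclideanSpace ℝ (Fin 2))}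
  {y : EuclideanSpace ℝ (Fin 2)} {p : M}

/-- The coefficients of the metric in the chart `e`, as a family of functions. -/
noncomputable def gramCoeff (g : Metric 2 M) (e : OpenPartialHomeomorph M (EuclideanSpace ℝ (Fin 2)))
    (i j : Fin 2) (y : EuclideanSpace ℝ (Fin 2)) : ℝ :=
  gram g e y i j

lemma contDiffAt_gramCoeff (g : Metric 2 M) (he : e ∈ IsManifold.maximalAtlas (𝓡 2) ∞ M)
    (hy : y ∈ e.target) (i j : Fin 2) : ContDiffAt ℝ ∞ (gramCoeff g e i j) y :=
  contDiffAt_gram g he hy i j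

lemma inner_eq (g : Metric 2 M) (he : e ∈ IsManifold.maximalAtlas (𝓡 2) ∞ M)
    (hp : p ∈ e.source) (u v : TangentSpace (𝓡 2) p) :
    g.inner p u v = gramCoeff g e 0 0 (e p) * (component e p u 0 * component e p v 0)
      + gramCoeff g e 0 1 (e p) * (component e p u 0 * component e p v 1
        + component e p u 1 * component e p v 0)
      + gramCoeff g e 1 1 (e p) * (component e p u 1 * component e p v 1) := by
  rw [inner_eq_sum g he hp]
  simp only [Fin.sum_univ_two, gramCoeff, gram_comm g 1 0]
  ring

lemma gramCoeff_pos (g : Metric 2 M) (he : e ∈ IsManifold.maximalAtlas (𝓡 2) ∞ M)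
    (hy : y ∈ e.target) : 0 < gramCoeff g e 0 0 y ∧ 0 < gramCoeff g e 1 1 y ∧
      0 < gramDet (gramCoeff g e) y := by
  have key : ∀ a b : ℝ, a ≠ 0 ∨ b ≠ 0 → 0 < gramCoeff g e 0 0 y * (a * a) +
      gramCoeff g e 0 1 y * (a * b + b * a) + gramCoeff g e 1 1 y * (b * b) := by
    intro a b hab
    have hp := e.map_target hy
    obtain ⟨u, hu⟩ := (mdifferentiable_of_mem_maximalAtlas he).mfderiv_surjective hp
      (WithLp.toLp 2 ![a, b] : EuclideanSpace ℝ (Fin 2))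
    have h0 : component e (e.symm y) u 0 = a := by rw [component, hu]; simp
    have h1 : component e (e.symm y) u 1 = b := by rw [component, hu]; simp
    have hne : u ≠ 0 := by
      rintro rfl
      have h2 : ∀ i, component e (e.symm y) 0 i = 0 := fun i => by rw [component, map_zero]; rfl
      rw [h2] at h0 h1
      rcases hab with h | h
      · exact h h0.symm
      · exact h h1.symm
    have := g.pos _ u hne
    rwa [inner_eq g he hp, h0, h1, e.right_inv hy] at this
  have p0 := key 1 0 (by simp)
  have p1 := key 0 1 (by simp)
  simp only [mul_one, mul_zero, add_zero, zero_add] at p0 p1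
  refine ⟨p0, p1, ?_⟩
  have := key (-gramCoeff g e 0 1 y) (gramCoeff g e 0 0 y) (Or.inr p0.ne')
  unfold gramDet
  have h2 : 0 < gramCoeff g e 0 0 y * (gramCoeff g e 0 0 y * gramCoeff g e 1 1 y
      - gramCoeff g e 0 1 y * gramCoeff g e 0 1 y) := by linarith
  exact pos_of_mul_pos_right h2 p0.le

lemma gram_inv (g : Metric 2 M) : (gram g e y)⁻¹ =
    (gramDet (gramCoeff g e) y)⁻¹ • !![gramCoeff g e 1 1 y, -gramCoeff g e 0 1 y;
      -gramCoeff g e 0 1 y, gramCoeff g e 0 0 y] := by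
  rw [Matrix.inv_def, Matrix.adjugate_fin_two, Matrix.det_fin_two, Ring.inverse_eq_inv',
    gram_comm g 1 0]
  rfl

/-- The Christoffel symbols of the metric are those of its Levi-Civita connection. -/
lemma isLeviCivitaNear (g : Metric 2 M) (he : e ∈ IsManifold.maximalAtlas (𝓡 2) ∞ M)
    (hy : y ∈ e.target) : IsLeviCivitaNear (gramCoeff g e) (christoffel g e) y := by
  have hsm := contDiffAt_gramCoeff g he hy
  have hsymm : ∀ i j, gramCoeff g e i j = gramCoeff g e j i := fun i j =>
    funext fun z => gram_comm g i j
  have hpos := gramCoeff_pos g he hy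
  refine ⟨hsm, ?_, hsymm, ?_, ?_, ?_⟩
  · intro k i j
    have hinv : ∀ k l, ContDiffAt ℝ ∞ (fun z => (gram g e z)⁻¹ k l) y := by
      intro k l
      have hd := (contDiffAt_gramDet hsm).inv hpos.2.2.ne'
      simp only [gram_inv, Matrix.smul_apply, smul_eq_mul]
      refine hd.mul ?_
      fin_cases k <;> fin_cases l <;> simp <;> first | exact hsm _ _ | exact (hsm _ _).neg
    have hpd : ∀ k i j, ContDiffAt ℝ ∞ (partialDeriv k fun z => gram g e z i j) y :=
      fun k i j => contDiffAt_partialDeriv k (hsm i j)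
    unfold christoffel
    exact contDiffAt_const.mul (ContDiffAt.sum fun l _ =>
      (hinv k l).mul (((hpd i j l).add (hpd j i l)).sub (hpd l i j)))
  · intro k i j
    have hs : ∀ i j, (fun z => gram g e z i j) = fun z => gram g e z j i := hsymm
    funext z
    unfold christoffel
    rw [hs i j]
    congr 1
    refine Finset.sum_congr rfl fun l _ => ?_
    ring
  · filter_upwards [e.open_target.mem_nhds hy] with z hz
    exact gramCoeff_pos g he hz
  · intro k i j
    filter_upwards [e.open_target.mem_nhds hy] with z hz
    obtain ⟨p0, p1, pd⟩ := gramCoeff_pos g he hz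
    have key : ∀ m i j, ∑ l, gramCoeff g e l m z * christoffel g e l i j z =
        (1 / 2) * (partialDeriv i (gramCoeff g e j m) z + partialDeriv j (gramCoeff g e i m) z
          - partialDeriv m (gramCoeff g e i j) z) := by
      intro m i j
      have hc : ∀ l, christoffel g e l i j z = (1 / 2) * ∑ q, (gram g e z)⁻¹ l q *
        (partialDeriv i (gramCoeff g e j q) z + partialDeriv j (gramCoeff g e i q) z
          - partialDeriv q (gramCoeff g e i j) z) := fun l => rfl
      simp only [hc, gram_inv, Matrix.smul_apply, smul_eq_mul, Fin.sum_univ_two]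
      have pd' : gramDet (gramCoeff g e) z ≠ 0 := pd.ne'
      fin_cases m <;> simp [hsymm 1 0] <;> field_simp <;> unfold gramDet <;> ring
    simp only [Finset.sum_add_distrib]
    have h2 : ∑ l, gramCoeff g e i l z * christoffel g e l k j z =
        ∑ l, gramCoeff g e l i z * christoffel g e l k j z :=
      Finset.sum_congr rfl fun l _ => by rw [hsymm i l]
    rw [h2, key, key, hsymm j i]
    ring

/-- On a surface the Ricci tensor is half the scalar curvature times the metric. -/
lemma ricciCoord_eq (g : Metric 2 M) (he : e ∈ IsManifold.maximalAtlas (𝓡 2) ∞ M)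
    (hy : y ∈ e.target) (i j : Fin 2) :
    ricciCoord g e i j y = scalarCoord g e y / 2 * gramCoeff g e i j y := by
  have h := (isLeviCivitaNear g he hy).ricciOf_eq i j
  have hr : ∀ i j, ricciCoord g e i j y = ricciOf (christoffel g e) i j y := fun i j => rfl
  rw [hr, h]
  congr 2
  simp only [scalarCoord, hr, gram_inv, Matrix.smul_apply, smul_eq_mul, Fin.sum_univ_two]
  simp [gramDet]
  ring

/-- Change of coordinates for the Lie derivative of a metric, along the coordinate change `T`. -/
lemma lieOf_change {G G' : Fin 2 → Fin 2 → EuclideanSpace ℝ (Fin 2) → ℝ}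
    {V V' : Fin 2 → EuclideanSpace ℝ (Fin 2) → ℝ}
    {T : EuclideanSpace ℝ (Fin 2) → EuclideanSpace ℝ (Fin 2)}
    (hT : ContDiffAt ℝ ∞ T y) (hG' : ∀ i j, DifferentiableAt ℝ (G' i j) (T y))
    (hV : ∀ i, DifferentiableAt ℝ (V i) y) (hV' : ∀ i, DifferentiableAt ℝ (V' i) (T y))
    (hG : ∀ i j, ∀ᶠ z in 𝓝 y, G i j z = ∑ a, ∑ b, G' a b (T z) *
      (partialDeriv i (fun x => T x a) z * partialDeriv j (fun x => T x b) z))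
    (hVV : ∀ a, ∀ᶠ z in 𝓝 y, V' a (T z) = ∑ i, partialDeriv i (fun x => T x a) z * V i z)
    (i j : Fin 2) :
    lieOf G V i j y = ∑ a, ∑ b, lieOf G' V' a b (T y) *
      (partialDeriv i (fun x => T x a) y * partialDeriv j (fun x => T x b) y) := by
  have hTd : DifferentiableAt ℝ T y := hT.differentiableAt (by simp)
  have hTa : ∀ a, ContDiffAt ℝ ∞ (fun x => T x a) y := fun a =>
    (contDiff_coord a).contDiffAt.comp y hT
  have hTad : ∀ a i, DifferentiableAt ℝ (partialDeriv i (fun x => T x a)) y := fun a i =>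
    (contDiffAt_partialDeriv i (hTa a)).differentiableAt (by simp)
  have hcomm : ∀ a k l, partialDeriv k (partialDeriv l (fun x => T x a)) y =
      partialDeriv l (partialDeriv k (fun x => T x a)) y := fun a k l =>
    partialDeriv_comm k l (hTa a)
  have hGT : ∀ a b, DifferentiableAt ℝ (fun z => G' a b (T z)) y := fun a b => (hG' a b).comp y hTd
  have dG : ∀ k i j, partialDeriv k (G i j) y = ∑ a, ∑ b,
      (G' a b (T y) * (partialDeriv i (fun x => T x a) y *
          partialDeriv k (partialDeriv j (fun x => T x b)) y
        + partialDeriv j (fun x => T x b) y * partialDeriv k (partialDeriv i (fun x => T x a)) y)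
      + (partialDeriv i (fun x => T x a) y * partialDeriv j (fun x => T x b) y) *
        ∑ c, partialDeriv c (G' a b) (T y) * partialDeriv k (fun x => T x c) y) := by
    intro k i j
    rw [partialDeriv_congr k (hG i j)]
    simp only [Fin.sum_univ_two]
    have hp : ∀ a b, DifferentiableAt ℝ (fun z => G' a b (T z) *
      (partialDeriv i (fun x => T x a) z * partialDeriv j (fun x => T x b) z)) y := fun a b =>
      (hGT a b).fun_mul ((hTad a i).fun_mul (hTad b j))
    rw [partialDeriv_add _ ((hp 0 0).fun_add (hp 0 1)) ((hp 1 0).fun_add (hp 1 1)),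
      partialDeriv_add _ (hp 0 0) (hp 0 1), partialDeriv_add _ (hp 1 0) (hp 1 1)]
    simp only [fun a b => partialDeriv_mul k (hGT a b) ((hTad a i).fun_mul (hTad b j)),
      fun a b => partialDeriv_mul k (hTad a i) (hTad b j),
      fun a b => partialDeriv_comp (hG' a b) hTd k, Fin.sum_univ_two]
  have dV : ∀ k a, ∑ c, partialDeriv c (V' a) (T y) * partialDeriv k (fun x => T x c) y =
      ∑ i, (partialDeriv i (fun x => T x a) y * partialDeriv k (V i) y
        + V i y * partialDeriv k (partialDeriv i (fun x => T x a)) y) := by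
    intro k a
    rw [← partialDeriv_comp (hV' a) hTd, partialDeriv_congr k (hVV a)]
    simp only [Fin.sum_univ_two]
    rw [partialDeriv_add _ ((hTad a 0).fun_mul (hV 0)) ((hTad a 1).fun_mul (hV 1)),
      partialDeriv_mul _ (hTad a 0) (hV 0), partialDeriv_mul _ (hTad a 1) (hV 1)]
  have hVy := fun a => (hVV a).self_of_nhds
  have hGy := fun i j => (hG i j).self_of_nhds
  have dVi := fun a => dV i a
  have dVj := fun a => dV j a
  simp only [Fin.sum_univ_two] at dVi dVj
  simp only [lieOf, Fin.sum_univ_two, dG, hGy, hVy, fun a => hcomm a 0 i, fun a => hcomm a 1 i,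
    fun a => hcomm a 0 j, fun a => hcomm a 1 j]
  linear_combination
    - (G' 0 0 (T y) * partialDeriv j (fun x => T x 0) y
        + G' 0 1 (T y) * partialDeriv j (fun x => T x 1) y) * dVi 0
    - (G' 1 0 (T y) * partialDeriv j (fun x => T x 0) y
        + G' 1 1 (T y) * partialDeriv j (fun x => T x 1) y) * dVi 1
    - (G' 0 0 (T y) * partialDeriv i (fun x => T x 0) y
        + G' 1 0 (T y) * partialDeriv i (fun x => T x 1) y) * dVj 0
    - (G' 0 1 (T y) * partialDeriv i (fun x => T x 0) y
        + G' 1 1 (T y) * partialDeriv i (fun x => T x 1) y) * dVj 1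

end Surface

/-! ### Solitons on surfaces -/

section Soliton

variable {M : Type*} [TopologicalSpace M]
  [ChartedSpace (EuclideanSpace ℝ (Fin 2)) M] [IsManifold (𝓡 2) ∞ M]
  {e e' : OpenPartialHomeomorph M (EuclideanSpace ℝ (Fin 2))}
  {y : EuclideanSpace ℝ (Fin 2)} {p : M}
  {g : Metric 2 M} {V : (x : M) → TangentSpace (𝓡 2) x} {lam : M → ℝ}

/-- On a surface the soliton equation says that `V` is conformal. -/
lemma IsAlmostRicciSoliton.lieOf_chartAt (hsol : IsAlmostRicciSoliton g V lam) (p : M)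
    (i j : Fin 2) :
    lieOf (gramCoeff g (chartAt _ p)) (fieldCoord V (chartAt _ p)) i j (chartAt _ p p) =
      (scalarCurvature g p - 2 * lam p) * gramCoeff g (chartAt _ p) i j (chartAt _ p p) := by
  have he := IsManifold.chart_mem_maximalAtlas (I := 𝓡 2) (n := ∞) p
  have hp := mem_chart_source (EuclideanSpace ℝ (Fin 2)) p
  obtain ⟨u, hu⟩ := exists_component_eq he hp i
  obtain ⟨v, hv⟩ := exists_component_eq he hp j
  have h := hsol.eqn p u v
  rw [inner_eq_sum g he hp] at h
  simp only [ricci, lieMetric, hu, hv] at h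
  simp only [mul_ite, mul_one, mul_zero, Finset.sum_ite_eq', Finset.mem_univ, if_true] at h
  rw [ricciCoord_eq g he ((chartAt _ p).map_source hp)] at h
  have h1 : lieMetricCoord g V (chartAt _ p) i j (chartAt _ p p) =
    lieOf (gramCoeff g (chartAt _ p)) (fieldCoord V (chartAt _ p)) i j (chartAt _ p p) := rfl
  have h2 : scalarCurvature g p = scalarCoord g (chartAt _ p) (chartAt _ p p) := rfl
  have h3 : gram g (chartAt _ p) (chartAt _ p p) i j =
    gramCoeff g (chartAt _ p) i j (chartAt _ p p) := rfl
  rw [h1, ← h2, h3] at h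
  linear_combination -2 * h

lemma component_coordVector_change (he : e ∈ IsManifold.maximalAtlas (𝓡 2) ∞ M)
    (he' : e' ∈ IsManifold.maximalAtlas (𝓡 2) ∞ M) (hy : y ∈ e.target)
    (hy' : e.symm y ∈ e'.source) (i a : Fin 2) :
    component e' (e.symm y) (coordVector e i y) a =
      partialDeriv i (fun z => e' (e.symm z) a) y := by
  rw [component, mfderiv_apply_eq_sum he (e.map_target hy)
    ((mdifferentiable_of_mem_maximalAtlas he').mdifferentiableAt hy'), e.right_inv hy]
  simp [component_coordVector he hy]

/-- The conformal equation holds in every chart. -/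
lemma IsAlmostRicciSoliton.lieOf_eq (hsol : IsAlmostRicciSoliton g V lam)
    (he : e ∈ IsManifold.maximalAtlas (𝓡 2) ∞ M) (hy : y ∈ e.target) (i j : Fin 2) :
    lieOf (gramCoeff g e) (fieldCoord V e) i j y =
      (scalarCurvature g (e.symm y) - 2 * lam (e.symm y)) * gramCoeff g e i j y := by
  set e' := chartAt (EuclideanSpace ℝ (Fin 2)) (e.symm y) with he'def
  have he' : e' ∈ IsManifold.maximalAtlas (𝓡 2) ∞ M := IsManifold.chart_mem_maximalAtlas _
  have hy' : e.symm y ∈ e'.source := mem_chart_source _ _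
  have hT : ContDiffAt ℝ ∞ (fun z => e' (e.symm z)) y :=
    (((contMDiffOn_of_mem_maximalAtlas he').contMDiffAt (e'.open_source.mem_nhds hy')).comp y
      ((contMDiffOn_symm_of_mem_maximalAtlas he).contMDiffAt
        (e.open_target.mem_nhds hy))).contDiffAt
  have hTy : e' (e.symm y) ∈ e'.target := e'.map_source hy'
  have hnear : ∀ᶠ z in 𝓝 y, z ∈ e.target ∧ e.symm z ∈ e'.source :=
    (e.open_target.eventually_mem hy).and
      ((e.continuousAt_symm hy).eventually (e'.open_source.mem_nhds hy'))
  have hG : ∀ i j, ∀ᶠ z in 𝓝 y, gramCoeff g e i j z = ∑ a, ∑ b, gramCoeff g e' a b (e' (e.symm z)) *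
      (partialDeriv i (fun x => e' (e.symm x) a) z *
        partialDeriv j (fun x => e' (e.symm x) b) z) := by
    intro i j
    filter_upwards [hnear] with z hz
    have := inner_eq_sum g he' hz.2 (coordVector e i z) (coordVector e j z)
    simp only [component_coordVector_change he he' hz.1 hz.2] at this
    refine this.trans ?_
    refine Finset.sum_congr rfl fun a _ => Finset.sum_congr rfl fun b _ => ?_
    rw [mul_assoc]; rfl
  have hVV : ∀ a, ∀ᶠ z in 𝓝 y, fieldCoord V e' a (e' (e.symm z)) =
      ∑ i, partialDeriv i (fun x => e' (e.symm x) a) z * fieldCoord V e i z := by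
    intro a
    filter_upwards [hnear] with z hz
    rw [fieldCoord_apply V hz.2, component, mfderiv_apply_eq_sum he (e.map_target hz.1)
      ((mdifferentiable_of_mem_maximalAtlas he').mdifferentiableAt hz.2), e.right_inv hz.1]
    rfl
  rw [lieOf_change (T := fun z => e' (e.symm z)) hT
    (fun i j => (contDiffAt_gramCoeff g he' hTy i j).differentiableAt (by simp))
    (fun i => (contDiffAt_fieldCoord hsol.smooth_field he hy i).differentiableAt (by simp))
    (fun i => (contDiffAt_fieldCoord hsol.smooth_field he' hTy i).differentiableAt (by simp))
    hG hVV, (hG i j).self_of_nhds, Finset.mul_sum]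
  refine Finset.sum_congr rfl fun a _ => ?_
  rw [Finset.mul_sum]
  refine Finset.sum_congr rfl fun b _ => ?_
  rw [hsol.lieOf_chartAt (e.symm y) a b]
  ring

/-- The squared length of the field `V`. -/
noncomputable def fieldNormSq (g : Metric 2 M) (V : (x : M) → TangentSpace (𝓡 2) x) (p : M) : ℝ :=
  g.inner p (V p) (V p)

lemma fieldNormSq_eq (he : e ∈ IsManifold.maximalAtlas (𝓡 2) ∞ M) (hp : p ∈ e.source) :
    fieldNormSq g V p = normSq (gramCoeff g e) (fieldCoord V e) (e p) := by
  rw [fieldNormSq, inner_eq g he hp, normSq, fieldCoord_apply V hp, fieldCoord_apply V hp]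
  ring

lemma continuous_fieldNormSq (hsol : IsAlmostRicciSoliton g V lam) :
    Continuous (fieldNormSq g V) := by
  have : ContMDiff (𝓡 2) ((𝓡 2).prod 𝓘(ℝ)) ∞
      (fun x => Bundle.TotalSpace.mk' ℝ (E := Bundle.Trivial M ℝ) x
        (g.inner x (V x) (V x))) := by
    apply ContMDiff.clm_bundle_apply₂ (F₁ := EuclideanSpace ℝ (Fin 2))
      (F₂ := EuclideanSpace ℝ (Fin 2))
    · exact g.contMDiff
    · exact hsol.smooth_field
    · exact hsol.smooth_field
  refine continuous_iff_continuousAt.2 fun x => ?_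
  have h := this x
  rw [Bundle.contMDiffAt_totalSpace] at h
  exact h.2.continuousAt

lemma fieldCoord_ne_zero (he : e ∈ IsManifold.maximalAtlas (𝓡 2) ∞ M) (hp : p ∈ e.source)
    (hV : V p ≠ 0) : fieldCoord V e 0 (e p) ≠ 0 ∨ fieldCoord V e 1 (e p) ≠ 0 := by
  obtain ⟨i, hi⟩ := component_ne_zero he hp hV
  rw [fieldCoord_apply V hp, fieldCoord_apply V hp]
  fin_cases i
  · exact Or.inl hi
  · exact Or.inr hi

/-- The Bochner formula at the centre of a preferred chart. -/
lemma IsAlmostRicciSoliton.bochner (hsol : IsAlmostRicciSoliton g V lam) (p : M) (hV : V p ≠ 0)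
    (he : e = chartAt (EuclideanSpace ℝ (Fin 2)) p) :
    dirDeriv (fieldCoord V e) (dirDeriv (fieldCoord V e) fun z =>
        Real.log (normSq (gramCoeff g e) (fieldCoord V e) z)) (e p) +
      dirDeriv (rotated (gramCoeff g e) (fieldCoord V e))
        (dirDeriv (rotated (gramCoeff g e) (fieldCoord V e)) fun z =>
          Real.log (normSq (gramCoeff g e) (fieldCoord V e) z)) (e p) =
    - scalarCurvature g p * fieldNormSq g V p := by
  have hmem : e ∈ IsManifold.maximalAtlas (𝓡 2) ∞ M := by
    rw [he]; exact IsManifold.chart_mem_maximalAtlas _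
  have hp : p ∈ e.source := by rw [he]; exact mem_chart_source _ _
  have hs : scalarCurvature g p = scalarCoord g e (e p) := by rw [he]; rfl
  have hy := e.map_source hp
  rw [(isLeviCivitaNear g hmem hy).bochner
    (contDiffAt_fieldCoord hsol.smooth_field hmem hy)
    ((e.open_target.eventually_mem hy).mono fun z hz i j => hsol.lieOf_eq hmem hz i j)
    (fieldCoord_ne_zero hmem hp hV), fieldNormSq_eq hmem hp, hs]
  have hr : ∀ i j, ricciOf (christoffel g e) i j (e p) =
    scalarCoord g e (e p) / 2 * gramCoeff g e i j (e p) := ricciCoord_eq g hmem hy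
  have h10 : gramCoeff g e 1 0 (e p) = gramCoeff g e 0 1 (e p) := gram_comm g 1 0
  simp only [hr, Fin.sum_univ_two, h10, normSq]
  ring

/-- A soliton on a compact surface with negative scalar curvature is trivial: the Bochner formula
is tested at a maximum of `|V|²`. -/
lemma IsAlmostRicciSoliton.isTrivial [CompactSpace M] (hsol : IsAlmostRicciSoliton g V lam)
    (hs : ∀ x, scalarCurvature g x < 0) : IsTrivial V := by
  intro p
  obtain ⟨q, -, hq⟩ := isCompact_univ.exists_isMaxOn ⟨p, Set.mem_univ p⟩
    (continuous_fieldNormSq hsol).continuousOn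
  have hmax : ∀ x, fieldNormSq g V x ≤ fieldNormSq g V q := fun x => hq (Set.mem_univ x)
  by_cases hVq : V q = 0
  · by_contra hVp
    have h1 := hmax p
    have h2 : 0 < fieldNormSq g V p := g.pos p _ hVp
    have h3 : fieldNormSq g V q = 0 := by simp [fieldNormSq, hVq]
    linarith
  exfalso
  set e := chartAt (EuclideanSpace ℝ (Fin 2)) q with he
  have hmem : e ∈ IsManifold.maximalAtlas (𝓡 2) ∞ M := IsManifold.chart_mem_maximalAtlas _
  have hqs : q ∈ e.source := mem_chart_source _ _
  have hy := e.map_source hqs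
  have hNpos : 0 < fieldNormSq g V q := g.pos q _ hVq
  have hsm := contDiffAt_fieldCoord hsol.smooth_field hmem hy
  have hN0 := hNpos
  rw [fieldNormSq_eq hmem hqs] at hN0
  have hcd : ContDiffAt ℝ ∞ (fun z => Real.log (normSq (gramCoeff g e) (fieldCoord V e) z)) (e q) :=
    (contDiffAt_normSq (contDiffAt_gramCoeff g hmem hy) hsm).log hN0.ne'
  have hloc : IsLocalMax (fun z => Real.log (normSq (gramCoeff g e) (fieldCoord V e) z)) (e q) := by
    filter_upwards [e.open_target.eventually_mem hy,
      (contDiffAt_normSq (contDiffAt_gramCoeff g hmem hy) hsm).continuousAt.eventually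
        (lt_mem_nhds hN0)] with z hz hzpos
    refine Real.log_le_log hzpos ?_
    have h1 := hmax (e.symm z)
    rwa [fieldNormSq_eq hmem hqs, fieldNormSq_eq hmem (e.map_target hz), e.right_inv hz] at h1
  have h1 := dirDeriv_dirDeriv_nonpos hcd hsm hloc
  have h2 := dirDeriv_dirDeriv_nonpos hcd (contDiffAt_rotated (contDiffAt_gramCoeff g hmem hy)
    (gramCoeff_pos g hmem hy).2.2 hsm) hloc
  have h3 := hsol.bochner q hVq he
  have h4 := mul_pos (neg_pos.2 (hs q)) hNpos
  linarith

end Soliton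

/-! ### Flat charts -/

section FlatChart

variable {M : Type*} [TopologicalSpace M]
  [ChartedSpace (EuclideanSpace ℝ (Fin 2)) M] [IsManifold (𝓡 2) ∞ M]
  {e : OpenPartialHomeomorph M (EuclideanSpace ℝ (Fin 2))}
  {y : EuclideanSpace ℝ (Fin 2)} {p : M}
  {g : Metric 2 M} {V : (x : M) → TangentSpace (𝓡 2) x} {lam : M → ℝ}

/-- `Φ` is a smooth chart which is an isometry onto the Euclidean plane for the metric `g / |V|²`
and which sends the unit field `V` to the first coordinate field. -/
structure IsFlatChart (g : Metric 2 M) (V : (x : M) → TangentSpace (𝓡 2) x)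
    (Φ : OpenPartialHomeomorph M (EuclideanSpace ℝ (Fin 2))) : Prop where
  smooth : ContMDiffOn (𝓡 2) (𝓡 2) ∞ Φ Φ.source
  smooth_symm : ContMDiffOn (𝓡 2) (𝓡 2) ∞ Φ.symm Φ.target
  metric_eq : ∀ x ∈ Φ.source, ∀ u v : TangentSpace (𝓡 2) x,
    component Φ x u 0 * component Φ x v 0 + component Φ x u 1 * component Φ x v 1 =
      g.inner x u v / fieldNormSq g V x
  field_zero : ∀ x ∈ Φ.source, component Φ x (V x) 0 = 1
  field_one : ∀ x ∈ Φ.source, component Φ x (V x) 1 = 0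

lemma IsFlatChart.mem_maximalAtlas {Φ : OpenPartialHomeomorph M (EuclideanSpace ℝ (Fin 2))}
    (hΦ : IsFlatChart g V Φ) : Φ ∈ IsManifold.maximalAtlas (𝓡 2) ∞ M :=
  Φ.mem_maximalAtlas_of_contMDiffOn hΦ.smooth hΦ.smooth_symm

lemma coframe_det {G : Fin 2 → Fin 2 → EuclideanSpace ℝ (Fin 2) → ℝ}
    {V : Fin 2 → EuclideanSpace ℝ (Fin 2) → ℝ} (hN : normSq G V y ≠ 0) :
    coframe G V 0 0 y * coframe G V 1 1 y - coframe G V 0 1 y * coframe G V 1 0 y =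
      √(gramDet G y) / normSq G V y := by
  simp only [coframe, Matrix.cons_val_zero, Matrix.cons_val_one]
  field_simp
  unfold normSq
  ring

lemma coframe_inner {G : Fin 2 → Fin 2 → EuclideanSpace ℝ (Fin 2) → ℝ}
    {V : Fin 2 → EuclideanSpace ℝ (Fin 2) → ℝ} (hN : normSq G V y ≠ 0) (hd : 0 < gramDet G y)
    (u v : Fin 2 → ℝ) :
    (∑ i, coframe G V 0 i y * u i) * (∑ i, coframe G V 0 i y * v i) +
      (∑ i, coframe G V 1 i y * u i) * (∑ i, coframe G V 1 i y * v i) =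
      (G 0 0 y * (u 0 * v 0) + G 0 1 y * (u 0 * v 1 + u 1 * v 0) + G 1 1 y * (u 1 * v 1)) /
        normSq G V y := by
  have hs2 : √(gramDet G y) ^ 2 = gramDet G y := Real.sq_sqrt hd.le
  simp only [coframe, Matrix.cons_val_zero, Matrix.cons_val_one, Fin.sum_univ_two]
  field_simp
  ring_nf
  rw [hs2]
  unfold normSq gramDet
  ring

lemma coframe_field {G : Fin 2 → Fin 2 → EuclideanSpace ℝ (Fin 2) → ℝ}
    {V : Fin 2 → EuclideanSpace ℝ (Fin 2) → ℝ} (hN : normSq G V y ≠ 0) :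
    ∑ i, coframe G V 0 i y * V i y = 1 ∧ ∑ i, coframe G V 1 i y * V i y = 0 := by
  simp only [coframe, Matrix.cons_val_zero, Matrix.cons_val_one, Fin.sum_univ_two]
  constructor
  · field_simp
    unfold normSq
    ring
  · ring

/-- A smooth map of the plane whose Jacobian determinant does not vanish on an open set is, near
each point of that set, a diffeomorphism. -/
lemma exists_openPartialHomeomorph {F : EuclideanSpace ℝ (Fin 2) → EuclideanSpace ℝ (Fin 2)}
    {U : Set (EuclideanSpace ℝ (Fin 2))} (hU : IsOpen U) (hF : ContDiffOn ℝ ∞ F U)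
    (hdet : ∀ z ∈ U, partialDeriv 0 (fun x => F x 0) z * partialDeriv 1 (fun x => F x 1) z -
      partialDeriv 1 (fun x => F x 0) z * partialDeriv 0 (fun x => F x 1) z ≠ 0) (hy : y ∈ U) :
    ∃ ψ : OpenPartialHomeomorph (EuclideanSpace ℝ (Fin 2)) (EuclideanSpace ℝ (Fin 2)),
      y ∈ ψ.source ∧ ψ.source ⊆ U ∧ (∀ z, ψ z = F z) ∧ ContDiffOn ℝ ∞ ψ.symm ψ.target := by
  have hcd : ∀ z ∈ U, ContDiffAt ℝ ∞ F z := fun z hz => hF.contDiffAt (hU.mem_nhds hz)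
  have hfd : ∀ z ∈ U, ∃ f' : EuclideanSpace ℝ (Fin 2) ≃L[ℝ] EuclideanSpace ℝ (Fin 2),
      HasFDerivAt F (f' : EuclideanSpace ℝ (Fin 2) →L[ℝ] EuclideanSpace ℝ (Fin 2)) z := by
    intro z hz
    have hd : DifferentiableAt ℝ F z := (hcd z hz).differentiableAt (by simp)
    have hcomp : ∀ u a, fderiv ℝ F z u a = ∑ i, u i * partialDeriv i (fun x => F x a) z := by
      intro u a
      have h1 : fderiv ℝ (fun x => F x a) z = _ :=
        ((EuclideanSpace.proj (𝕜 := ℝ) a).hasFDerivAt.comp z hd.hasFDerivAt).fderiv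
      rw [← fderiv_eq_sum_partialDeriv, h1]
      rfl
    have hinj : Function.Injective (fderiv ℝ F z).toLinearMap := by
      refine (injective_iff_map_eq_zero _).2 fun u hu => ?_
      have h0 : fderiv ℝ F z u 0 = 0 := congrArg (fun w : EuclideanSpace ℝ (Fin 2) => w 0) hu
      have h1 : fderiv ℝ F z u 1 = 0 := congrArg (fun w : EuclideanSpace ℝ (Fin 2) => w 1) hu
      rw [hcomp, Fin.sum_univ_two] at h0 h1
      have hdz := hdet z hz
      have e0 : u 0 = 0 := by
        refine (mul_eq_zero.1 (?_ : _ * u 0 = 0)).resolve_left hdz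
        linear_combination partialDeriv 1 (fun x => F x 1) z * h0
          - partialDeriv 1 (fun x => F x 0) z * h1
      have e1 : u 1 = 0 := by
        refine (mul_eq_zero.1 (?_ : _ * u 1 = 0)).resolve_left hdz
        linear_combination partialDeriv 0 (fun x => F x 0) z * h1
          - partialDeriv 0 (fun x => F x 1) z * h0
      refine PiLp.ext fun i => ?_
      fin_cases i
      · exact e0
      · exact e1
    refine ⟨(LinearEquiv.ofInjectiveEndo _ hinj).toContinuousLinearEquiv, ?_⟩
    convert hd.hasFDerivAt using 1
    ext u
    rfl
  obtain ⟨f', hf'⟩ := hfd y hy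
  have hne : (∞ : ℕ∞ω) ≠ 0 := by simp
  set ψ := ((hcd y hy).toOpenPartialHomeomorph F hf' hne).restrOpen U hU with hψ
  have hsub : ψ.source ⊆ U := fun z hz => hz.2
  refine ⟨ψ, ⟨(hcd y hy).mem_toOpenPartialHomeomorph_source hf' hne, hy⟩, hsub, fun z => rfl, ?_⟩
  intro w hw
  have hw' := hsub (ψ.map_target hw)
  obtain ⟨f'', hf''⟩ := hfd _ hw'
  exact (ψ.contDiffAt_symm hw hf'' (hcd _ hw')).contDiffWithinAt

/-- A nowhere vanishing conformal field has a flat chart around every point: the two `1`-forms of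
the coframe are closed, and their primitives are the coordinates. -/
lemma IsAlmostRicciSoliton.exists_isFlatChart (hsol : IsAlmostRicciSoliton g V lam)
    (hV : ∀ x, V x ≠ 0) (p : M) :
    ∃ Φ : OpenPartialHomeomorph M (EuclideanSpace ℝ (Fin 2)), p ∈ Φ.source ∧ IsFlatChart g V Φ := by
  set e := chartAt (EuclideanSpace ℝ (Fin 2)) p with he
  have hmem : e ∈ IsManifold.maximalAtlas (𝓡 2) ∞ M := IsManifold.chart_mem_maximalAtlas _
  have hp : p ∈ e.source := mem_chart_source _ _
  obtain ⟨r, hr, hrU⟩ := Metric.isOpen_iff.1 e.open_target (e p) (e.map_source hp)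
  set U := Metric.ball (e p) r with hUdef
  have hG : ∀ z ∈ U, ∀ i j, ContDiffAt ℝ ∞ (gramCoeff g e i j) z := fun z hz =>
    contDiffAt_gramCoeff g hmem (hrU hz)
  have hW : ∀ z ∈ U, ∀ i, ContDiffAt ℝ ∞ (fieldCoord V e i) z := fun z hz =>
    contDiffAt_fieldCoord hsol.smooth_field hmem (hrU hz)
  have hd : ∀ z ∈ U, 0 < gramDet (gramCoeff g e) z := fun z hz =>
    (gramCoeff_pos g hmem (hrU hz)).2.2
  have hN : ∀ z ∈ U, 0 < normSq (gramCoeff g e) (fieldCoord V e) z := by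
    intro z hz
    have := fieldCoord_ne_zero hmem (e.map_target (hrU hz)) (hV (e.symm z))
    rw [e.right_inv (hrU hz)] at this
    exact normSq_pos (gramCoeff_pos g hmem (hrU hz)).1 (hd z hz) this
  have hprim : ∀ a, ∃ f : EuclideanSpace ℝ (Fin 2) → ℝ, ContDiffOn ℝ ∞ f U ∧
      ∀ z ∈ U, ∀ i, partialDeriv i f z = coframe (gramCoeff g e) (fieldCoord V e) a i z := fun a =>
    exists_primitive Metric.isOpen_ball (convex_ball _ _)
      (fun z hz i => contDiffAt_coframe (hG z hz) (hd z hz) (hW z hz) (hN z hz) a i)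
      (fun z hz => coframe_closed (fun i j => (hG z hz i j).differentiableAt (by simp))
        (fun i j => funext fun x => gram_comm g i j) (hd z hz)
        (fun i => (hW z hz i).differentiableAt (by simp)) (hN z hz)
        (hsol.lieOf_eq hmem (hrU hz)) a)
  choose f hfs hf using hprim
  set F : EuclideanSpace ℝ (Fin 2) → EuclideanSpace ℝ (Fin 2) := fun z =>
    WithLp.toLp 2 fun a => f a z with hFdef
  have hFs : ContDiffOn ℝ ∞ F U := by
    rw [contDiffOn_euclidean]
    exact hfs
  obtain ⟨ψ, hyψ, hψU, hψF, hψs⟩ := exists_openPartialHomeomorph Metric.isOpen_ball hFs (by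
    intro z hz
    have h1 : partialDeriv 0 (f 0) z * partialDeriv 1 (f 1) z -
        partialDeriv 1 (f 0) z * partialDeriv 0 (f 1) z ≠ 0 := by
      rw [hf 0 z hz, hf 1 z hz, hf 0 z hz, hf 1 z hz, coframe_det (hN z hz).ne']
      exact (div_pos (Real.sqrt_pos.2 (hd z hz)) (hN z hz)).ne'
    exact h1) (Metric.mem_ball_self hr)
  have hψsm : ContMDiffOn (𝓡 2) (𝓡 2) ∞ ψ ψ.source :=
    ((hFs.mono hψU).congr fun z _ => hψF z).contMDiffOn
  have hsmooth : ContMDiffOn (𝓡 2) (𝓡 2) ∞ (e.trans ψ) (e.trans ψ).source := by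
    rw [e.trans_source]
    exact hψsm.comp ((contMDiffOn_of_mem_maximalAtlas hmem).mono Set.inter_subset_left)
      fun x hx => hx.2
  have hsmooth' : ContMDiffOn (𝓡 2) (𝓡 2) ∞ (e.trans ψ).symm (e.trans ψ).target := by
    rw [e.trans_target]
    exact (contMDiffOn_symm_of_mem_maximalAtlas hmem).comp
      (hψs.contMDiffOn.mono Set.inter_subset_left) fun x hx => hx.2
  have hcomp : ∀ x ∈ (e.trans ψ).source, ∀ (u : TangentSpace (𝓡 2) x) (a : Fin 2),
      component (e.trans ψ) x u a =
        ∑ i, coframe (gramCoeff g e) (fieldCoord V e) a i (e x) * component e x u i := by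
    intro x hx u a
    have hx' := hx
    rw [e.trans_source] at hx'
    have hxU : e x ∈ U := hψU hx'.2
    rw [component, mfderiv_apply_eq_sum hmem hx'.1
      ((hsmooth.contMDiffAt ((e.trans ψ).open_source.mem_nhds hx)).mdifferentiableAt (by simp))]
    refine Finset.sum_congr rfl fun i _ => ?_
    congr 1
    rw [← hf a _ hxU i]
    refine partialDeriv_congr i ?_
    filter_upwards [e.open_target.mem_nhds (e.map_source hx'.1)] with z hz
    rw [OpenPartialHomeomorph.coe_trans, Function.comp_apply, e.right_inv hz, hψF]
  have hxU : ∀ x ∈ (e.trans ψ).source, x ∈ e.source ∧ e x ∈ U := by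
    intro x hx
    rw [e.trans_source] at hx
    exact ⟨hx.1, hψU hx.2⟩
  refine ⟨e.trans ψ, ?_, hsmooth, hsmooth', ?_, ?_, ?_⟩
  · rw [e.trans_source]; exact ⟨hp, hyψ⟩
  · intro x hx u v
    obtain ⟨hxe, hxU⟩ := hxU x hx
    rw [hcomp x hx, hcomp x hx, hcomp x hx, hcomp x hx, coframe_inner (hN _ hxU).ne' (hd _ hxU),
      fieldNormSq_eq hmem hxe, inner_eq g hmem hxe]
  · intro x hx
    obtain ⟨hxe, hxU⟩ := hxU x hx
    rw [hcomp x hx, ← (coframe_field (hN _ hxU).ne').1]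
    simp only [fieldCoord_apply V hxe]
  · intro x hx
    obtain ⟨hxe, hxU⟩ := hxU x hx
    rw [hcomp x hx, ← (coframe_field (hN _ hxU).ne').2]
    simp only [fieldCoord_apply V hxe]

end FlatChart

/-! ### Rigidity when the field has no zeros -/

section Rigidity

variable {M : Type*} [TopologicalSpace M]
  [ChartedSpace (EuclideanSpace ℝ (Fin 2)) M] [IsManifold (𝓡 2) ∞ M]
  {e Φ : OpenPartialHomeomorph M (EuclideanSpace ℝ (Fin 2))}
  {y : EuclideanSpace ℝ (Fin 2)} {p q : M}
  {g : Metric 2 M} {V : (x : M) → TangentSpace (𝓡 2) x} {lam : M → ℝ}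

lemma dirDeriv_dirDeriv_add {X : Fin 2 → EuclideanSpace ℝ (Fin 2) → ℝ}
    {f h : EuclideanSpace ℝ (Fin 2) → ℝ} (hX : ∀ i, ContDiffAt ℝ ∞ (X i) y)
    (hf : ContDiffAt ℝ ∞ f y) (hh : ContDiffAt ℝ ∞ h y) :
    dirDeriv X (dirDeriv X fun z => f z + h z) y =
      dirDeriv X (dirDeriv X f) y + dirDeriv X (dirDeriv X h) y := by
  have hd : ∀ {k : EuclideanSpace ℝ (Fin 2) → ℝ}, ContDiffAt ℝ ∞ k y →
      DifferentiableAt ℝ (dirDeriv X k) y := fun hk =>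
    (ContDiffAt.sum fun i _ => (hX i).mul (contDiffAt_partialDeriv i hk)).differentiableAt (by simp)
  have he : ∀ᶠ z in 𝓝 y, dirDeriv X (fun z => f z + h z) z = dirDeriv X f z + dirDeriv X h z := by
    filter_upwards [eventually_contDiffAt_one hf, eventually_contDiffAt_one hh] with z h1 h2
    simp only [dirDeriv, partialDeriv_add _ (h1.differentiableAt one_ne_zero)
      (h2.differentiableAt one_ne_zero), mul_add, Finset.sum_add_distrib]
  rw [dirDeriv_congr _ he]
  simp only [dirDeriv.eq_1 X _ y, partialDeriv_add _ (hd hf) (hd hh), mul_add,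
    Finset.sum_add_distrib]

/-- `log |V|²` is subharmonic, in the viscosity sense, in a flat chart. -/
lemma IsFlatChart.not_isLocalMax (hΦ : IsFlatChart g V Φ) (hsol : IsAlmostRicciSoliton g V lam)
    (hV : ∀ x, V x ≠ 0) (hs : ∀ x, scalarCurvature g x ≤ 0) {z : EuclideanSpace ℝ (Fin 2)}
    (hz : z ∈ Φ.target) {H : EuclideanSpace ℝ (Fin 2) → ℝ} (hH : ContDiffAt ℝ ∞ H z)
    (hpos : 0 < planeLaplacian H z) :
    ¬ IsLocalMax (fun x => Real.log (fieldNormSq g V (Φ.symm x)) + H x) z := by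
  intro hmax
  obtain ⟨q, hq, rfl⟩ : ∃ q ∈ Φ.source, Φ q = z := ⟨Φ.symm z, Φ.map_target hz, Φ.right_inv hz⟩
  set e := chartAt (EuclideanSpace ℝ (Fin 2)) q with he
  have hmem : e ∈ IsManifold.maximalAtlas (𝓡 2) ∞ M := IsManifold.chart_mem_maximalAtlas _
  have hqe : q ∈ e.source := mem_chart_source _ _
  have hy := e.map_source hqe
  have hsm := contDiffAt_fieldCoord hsol.smooth_field hmem hy
  have hG := contDiffAt_gramCoeff g hmem hy
  have hd := (gramCoeff_pos g hmem hy).2.2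
  have hrot := contDiffAt_rotated hG hd hsm
  have hNpos : ∀ x, 0 < fieldNormSq g V x := fun x => g.pos x _ (hV x)
  have hN0 : 0 < normSq (gramCoeff g e) (fieldCoord V e) (e q) := by
    rw [← fieldNormSq_eq hmem hqe]; exact hNpos q
  have hqe' : e.symm (e q) = q := e.left_inv hqe
  have hΦm := hΦ.mem_maximalAtlas
  set F : EuclideanSpace ℝ (Fin 2) → EuclideanSpace ℝ (Fin 2) := fun x => Φ (e.symm x) with hF
  have hFq : F (e q) = Φ q := by rw [hF]; simp only [hqe']
  have hFs : ContDiffAt ℝ ∞ F (e q) := by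
    refine (ContMDiffAt.comp (e q) (I' := 𝓡 2) ?_ ((contMDiffOn_symm_of_mem_maximalAtlas hmem).contMDiffAt
        (e.open_target.mem_nhds hy))).contDiffAt
    rw [hqe']
    exact hΦ.smooth.contMDiffAt (Φ.open_source.mem_nhds hq)
  have hnear : ∀ᶠ x in 𝓝 (e q), x ∈ e.target ∧ e.symm x ∈ Φ.source := by
    refine (e.open_target.eventually_mem hy).and
      ((e.continuousAt_symm hy).eventually (Φ.open_source.mem_nhds ?_))
    rwa [hqe']
  have hcd : ContDiffAt ℝ ∞ (fun x => Real.log (normSq (gramCoeff g e) (fieldCoord V e) x)) (e q) :=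
    (contDiffAt_normSq hG hsm).log hN0.ne'
  have hHF : ContDiffAt ℝ ∞ (fun x => H (F x)) (e q) :=
    ContDiffAt.comp (e q) (by rw [hFq]; exact hH) hFs
  have hloc : IsLocalMax (fun x => Real.log (normSq (gramCoeff g e) (fieldCoord V e) x) + H (F x))
      (e q) := by
    have htend : Tendsto F (𝓝 (e q)) (𝓝 (Φ q)) := by
      rw [← hFq]; exact hFs.continuousAt
    have hval : ∀ x, x ∈ e.target → e.symm x ∈ Φ.source →
        Real.log (fieldNormSq g V (Φ.symm (F x))) =
          Real.log (normSq (gramCoeff g e) (fieldCoord V e) x) := by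
      intro x hx hx'
      rw [hF]
      simp only [Φ.left_inv hx']
      rw [fieldNormSq_eq hmem (e.map_target hx), e.right_inv hx]
    filter_upwards [hnear, htend.eventually hmax] with x hx hxm
    rw [← hFq] at hxm
    rwa [hval x hx.1 hx.2, hval (e q) hy (by rwa [hqe'])] at hxm
  -- the frame `V`, `rotated V` read in the flat chart
  have hdir : ∀ x, x ∈ e.target → e.symm x ∈ Φ.source → ∀ u : TangentSpace (𝓡 2) (e.symm x),
      ∀ X : Fin 2 → EuclideanSpace ℝ (Fin 2) → ℝ, (∀ i, component e (e.symm x) u i = X i x) →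
      ∀ a, dirDeriv X (fun z => F z a) x = component Φ (e.symm x) u a := by
    intro x hx hx' u X hu a
    rw [component, mfderiv_apply_eq_sum hmem (e.map_target hx)
      ((mdifferentiable_of_mem_maximalAtlas hΦm).mdifferentiableAt hx'), e.right_inv hx]
    refine Finset.sum_congr rfl fun i _ => ?_
    rw [hu i, mul_comm]
  have hVF : ∀ x, x ∈ e.target → e.symm x ∈ Φ.source → ∀ a,
      dirDeriv (fieldCoord V e) (fun z => F z a) x = component Φ (e.symm x) (V (e.symm x)) a :=
    fun x hx hx' => hdir x hx hx' _ _ fun i => rfl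
  have hWF : ∀ x, x ∈ e.target → e.symm x ∈ Φ.source →
      dirDeriv (rotated (gramCoeff g e) (fieldCoord V e)) (fun z => F z 0) x = 0 ∧
      dirDeriv (rotated (gramCoeff g e) (fieldCoord V e)) (fun z => F z 1) x ^ 2 = 1 := by
    intro x hx hx'
    have hxe := e.map_target hx
    obtain ⟨w, hw⟩ := (mdifferentiable_of_mem_maximalAtlas hmem).mfderiv_surjective hxe
      (WithLp.toLp 2 fun i => rotated (gramCoeff g e) (fieldCoord V e) i x :
        EuclideanSpace ℝ (Fin 2))
    have hwi : ∀ i, component e (e.symm x) w i = rotated (gramCoeff g e) (fieldCoord V e) i x := by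
      intro i
      rw [component, hw]
      rfl
    have hVi : ∀ i, component e (e.symm x) (V (e.symm x)) i = fieldCoord V e i x := fun i => rfl
    have hdx := (gramCoeff_pos g hmem hx).2.2
    have hsq : √(gramDet (gramCoeff g e) x) ^ 2 = gramDet (gramCoeff g e) x := Real.sq_sqrt hdx.le
    have hspos := Real.sqrt_pos.2 hdx
    have hNx := hNpos (e.symm x)
    have h1 := hΦ.metric_eq _ hx' w (V (e.symm x))
    have h2 := hΦ.metric_eq _ hx' w w
    rw [hΦ.field_zero _ hx', hΦ.field_one _ hx'] at h1
    have hwV : g.inner (e.symm x) w (V (e.symm x)) = 0 := by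
      rw [inner_eq g hmem hxe, e.right_inv hx]
      simp only [hwi, hVi, rotated, Matrix.cons_val_zero, Matrix.cons_val_one]
      ring
    have hww : g.inner (e.symm x) w w = fieldNormSq g V (e.symm x) := by
      rw [fieldNormSq_eq hmem hxe, inner_eq g hmem hxe, e.right_inv hx]
      simp only [hwi, rotated, Matrix.cons_val_zero, Matrix.cons_val_one]
      field_simp
      rw [hsq]
      unfold normSq gramDet
      ring
    rw [hwV, zero_div, mul_one, mul_zero, add_zero] at h1
    rw [hww, h1, div_self hNx.ne'] at h2
    rw [hdir x hx hx' w _ hwi, hdir x hx hx' w _ hwi]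
    exact ⟨h1, by linear_combination h2⟩
  have hlap := dirDeriv_dirDeriv_comp (F := F) (H := H) (V := fieldCoord V e) hFs
    (by rw [hFq]; exact hH) hrot
    (hnear.mono fun x hx => by rw [hVF x hx.1 hx.2, hΦ.field_zero _ hx.2])
    (hnear.mono fun x hx => by rw [hVF x hx.1 hx.2, hΦ.field_one _ hx.2])
    (hnear.mono fun x hx => (hWF x hx.1 hx.2).1) (hnear.mono fun x hx => (hWF x hx.1 hx.2).2)
  rw [hFq] at hlap
  have h1 := dirDeriv_dirDeriv_nonpos (hcd.add hHF) hsm hloc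
  have h2 := dirDeriv_dirDeriv_nonpos (hcd.add hHF) hrot hloc
  have h1' := dirDeriv_dirDeriv_add hsm hcd hHF
  have h2' := dirDeriv_dirDeriv_add hrot hcd hHF
  have h3 := hsol.bochner q (hV q) he
  have h4 := mul_nonneg (neg_nonneg.2 (hs q)) (hNpos q).le
  change dirDeriv _ (dirDeriv _ fun z => _ + _) _ ≤ 0 at h1 h2
  linarith

/-- The strong maximum principle for `|V|²`. -/
lemma IsAlmostRicciSoliton.fieldNormSq_eventually_eq (hsol : IsAlmostRicciSoliton g V lam)
    (hV : ∀ x, V x ≠ 0) (hs : ∀ x, scalarCurvature g x ≤ 0)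
    (hmax : IsLocalMax (fieldNormSq g V) q) :
    ∀ᶠ x in 𝓝 q, fieldNormSq g V x = fieldNormSq g V q := by
  obtain ⟨Φ, hq, hΦ⟩ := hsol.exists_isFlatChart hV q
  have hNpos : ∀ x, 0 < fieldNormSq g V x := fun x => g.pos x _ (hV x)
  have hzt := Φ.map_source hq
  have hnear : ∀ᶠ z in 𝓝 (Φ q), z ∈ Φ.target ∧
      fieldNormSq g V (Φ.symm z) ≤ fieldNormSq g V q := by
    have h1 : Tendsto Φ.symm (𝓝 (Φ q)) (𝓝 q) := by
      simpa [ContinuousAt, Φ.left_inv hq] using Φ.continuousAt_symm hzt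
    exact (Φ.open_target.eventually_mem hzt).and (h1.eventually hmax)
  obtain ⟨r, hr, hrU⟩ := Metric.eventually_nhds_iff_ball.1 hnear
  have h4 : 4 * (r / 4) = r := by ring
  have key := eq_of_isMax_of_viscosity_subharmonic (R := r / 4) (c := Φ q)
    (u := fun z => Real.log (fieldNormSq g V (Φ.symm z))) (by
      rw [h4]
      exact ContinuousOn.log ((continuous_fieldNormSq hsol).comp_continuousOn
        (Φ.continuousOn_symm.mono fun z hz => (hrU z hz).1)) fun z _ => (hNpos _).ne')
    (by
      rw [h4]
      intro z hz
      rw [Φ.left_inv hq]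
      exact Real.log_le_log (hNpos _) (hrU z hz).2)
    (by
      rw [h4]
      exact fun z hz H hH hpos => hΦ.not_isLocalMax hsol hV hs (hrU z hz).1 hH hpos)
  filter_upwards [Φ.open_source.mem_nhds hq,
    (Φ.continuousAt hq).eventually (Metric.ball_mem_nhds (Φ q) (by positivity : 0 < r / 4))]
    with x hx hxb
  have h1 := key _ hxb
  rw [Φ.left_inv hx, Φ.left_inv hq] at h1
  exact Real.log_injOn_pos (Set.mem_Ioi.2 (hNpos _)) (Set.mem_Ioi.2 (hNpos _)) h1

/-- If `V` has no zeros and the scalar curvature is nonpositive, then `|V|²` is locally constant. -/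
lemma IsAlmostRicciSoliton.fieldNormSq_eqOn [CompactSpace M] (hsol : IsAlmostRicciSoliton g V lam)
    (hV : ∀ x, V x ≠ 0) (hs : ∀ x, scalarCurvature g x ≤ 0) (p : M) :
    IsOpen (connectedComponent p) ∧
      ∀ x ∈ connectedComponent p, fieldNormSq g V x = fieldNormSq g V p := by
  have : LocallyConnectedSpace M := ChartedSpace.locallyConnectedSpace (EuclideanSpace ℝ (Fin 2)) M
  have hopen : IsOpen (connectedComponent p) := isOpen_connectedComponent
  obtain ⟨q, hq, hqmax⟩ := isClosed_connectedComponent.isCompact.exists_isMaxOn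
    ⟨p, mem_connectedComponent⟩ (continuous_fieldNormSq hsol).continuousOn
  have hqmax' : ∀ x ∈ connectedComponent p, fieldNormSq g V x ≤ fieldNormSq g V q :=
    fun x hx => hqmax hx
  have hsub : connectedComponent p ⊆
      {x | ∀ᶠ z in 𝓝 x, fieldNormSq g V z = fieldNormSq g V q} := by
    refine isPreconnected_connectedComponent.subset_of_closure_inter_subset
      isOpen_setOfPred_eventually_nhds ⟨q, hq, ?_⟩ ?_
    · exact hsol.fieldNormSq_eventually_eq hV hs
        (Filter.mem_of_superset (hopen.mem_nhds hq) hqmax')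
    · rintro x ⟨hx, hxC⟩
      have hxq : fieldNormSq g V x = fieldNormSq g V q := by
        have hcl : IsClosed {x | fieldNormSq g V x = fieldNormSq g V q} :=
          isClosed_eq (continuous_fieldNormSq hsol) continuous_const
        exact closure_minimal (fun z hz => Eventually.self_of_nhds hz) hcl hx
      have := hsol.fieldNormSq_eventually_eq hV hs (q := x)
        (Filter.mem_of_superset (hopen.mem_nhds hxC) fun z hz => by
          simpa [hxq] using hqmax' z hz)
      simpa [hxq] using this
  refine ⟨hopen, fun x hx => ?_⟩
  rw [Eventually.self_of_nhds (hsub hx), Eventually.self_of_nhds (hsub mem_connectedComponent)]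

/-- Rescaling a flat chart by the constant length of `V` gives a local isometry to the plane. -/
lemma IsAlmostRicciSoliton.locallyIsometric [CompactSpace M] (hsol : IsAlmostRicciSoliton g V lam)
    (hV : ∀ x, V x ≠ 0) (hs : ∀ x, scalarCurvature g x ≤ 0) :
    LocallyIsometricToEuclidean g := by
  intro p
  obtain ⟨Φ, hp, hΦ⟩ := hsol.exists_isFlatChart hV p
  obtain ⟨hopen, hconst⟩ := hsol.fieldNormSq_eqOn hV hs p
  have hNpos : ∀ x, 0 < fieldNormSq g V x := fun x => g.pos x _ (hV x)
  set c := √(fieldNormSq g V p) with hc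
  have hc0 : c ≠ 0 := (Real.sqrt_pos.2 (hNpos p)).ne'
  have hc2 : c ^ 2 = fieldNormSq g V p := Real.sq_sqrt (hNpos p).le
  set δ : EuclideanSpace ℝ (Fin 2) ≃ₜ EuclideanSpace ℝ (Fin 2) := Homeomorph.smulOfNeZero c hc0 with hδ
  set Ψ := (Φ.restrOpen (connectedComponent p) hopen).transHomeomorph δ with hΨ
  have hsrc : Ψ.source = Φ.source ∩ connectedComponent p := rfl
  have hfun : ∀ x, Ψ x = c • Φ x := fun x => rfl
  have hmem : ∀ z ∈ Ψ.target, c⁻¹ • z ∈ Φ.target := by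
    intro z hz
    have h1 := Ψ.map_target hz
    rw [hsrc] at h1
    have h2 := Φ.map_source h1.1
    have h3 := hfun (Ψ.symm z)
    rw [Ψ.right_inv hz] at h3
    rwa [h3, smul_smul, inv_mul_cancel₀ hc0, one_smul]
  refine ⟨Ψ, ⟨hp, mem_connectedComponent⟩, ?_, ?_, ?_⟩
  · have h1 : ContMDiff (𝓡 2) (𝓡 2) ∞ fun z : EuclideanSpace ℝ (Fin 2) => c • z :=
      (contDiff_id.const_smul _).contMDiff
    exact h1.comp_contMDiffOn (hΦ.smooth.mono Set.inter_subset_left)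
  · have h1 : ContMDiff (𝓡 2) (𝓡 2) ∞ fun z : EuclideanSpace ℝ (Fin 2) => c⁻¹ • z :=
      (contDiff_id.const_smul _).contMDiff
    exact hΦ.smooth_symm.comp h1.contMDiffOn hmem
  · intro x hx u v
    have hxΦ : x ∈ Φ.source := hx.1
    have hd := (hΦ.smooth.contMDiffAt (Φ.open_source.mem_nhds hxΦ)).mdifferentiableAt
      (by simp : (∞ : ℕ∞ω) ≠ 0)
    have hder : ∀ w : TangentSpace (𝓡 2) x, (mfderiv (𝓡 2) (𝓡 2) Ψ x w : EuclideanSpace ℝ (Fin 2)) =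
        c • (mfderiv (𝓡 2) (𝓡 2) Φ x w : EuclideanSpace ℝ (Fin 2)) := by
      intro w
      have h1 : HasMFDerivAt (𝓡 2) (𝓡 2) (Ψ : M → EuclideanSpace ℝ (Fin 2)) x _ :=
        hd.hasMFDerivAt.const_smul c
      rw [h1.mfderiv]
      rfl
    have h2 : ∀ a b : EuclideanSpace ℝ (Fin 2),
        inner ℝ (c • a) (c • b) = c ^ 2 * (a 0 * b 0 + a 1 * b 1) := by
      intro a b
      rw [inner_smul_left, inner_smul_right, PiLp.inner_apply, Fin.sum_univ_two]
      simp
      ring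
    rw [hder, hder]
    refine (h2 _ _).trans ?_
    have h1 := hΦ.metric_eq x hxΦ u v
    rw [hconst x hx.2, ← hc2, eq_div_iff (pow_ne_zero 2 hc0), mul_comm] at h1
    exact h1

end Rigidity

end AlmostRicciSoliton

theorem corollary4 {M : Type*} [TopologicalSpace M] [T2Space M] [CompactSpace M]
    [ChartedSpace (EuclideanSpace ℝ (Fin 2)) M] [IsManifold (𝓡 2) ∞ M]
    (g : AlmostRicciSoliton.Metric 2 M) (V : (x : M) → TangentSpace (𝓡 2) x) (lam : M → ℝ)
    (hsol : AlmostRicciSoliton.IsAlmostRicciSoliton g V lam)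
    (hs : ∀ x, AlmostRicciSoliton.scalarCurvature g x ≤ 0) :
    ((∀ x, AlmostRicciSoliton.scalarCurvature g x < 0) → AlmostRicciSoliton.IsTrivial V) ∧
    ((∀ x, V x ≠ 0) → AlmostRicciSoliton.LocallyIsometricToEuclidean g) :=
  ⟨hsol.isTrivial, fun hV => hsol.locallyIsometric hV hs⟩
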